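/- **Theorem 5.1.** Let $C=\begin{bmatrix}\alpha&\beta\\-\overline\beta&\overline\alpha\end{bmatrix}\in \mathrm{SU}(2)$ with $\alpha\neq0$ and $\beta\neq 0$, and let $U$ be the homogeneous quantum walk with constant coin $C$, i.e. the unitary operator on $\ell^2(\mathbb Z,\mathbb C^2)$ $$(U\Psi)(x)=\pi_L C\,\Psi(x+1)+\pi_R C\,\Psi(x-1),\qquad x\in\mathbb Z,$$ where $\pi_L,\pi_R$ are the orthogonal projections of $\mathbb C^2$ onto the first and second coordinate axis. For $\lambda\in\mathbb C\setminus\{0\}$ let $$T(\lambda)=\begin{bmatrix}\frac1\alpha(\lambda+\lambda^{-1}|\beta|^2)&-\lambda^{-1}\frac{\beta\overline\alpha}{\alpha}\\-\lambda^{-1}\overline\beta&\lambda^{-1}\overline\alpha\end{bmatrix},\qquad F_\lambda(x)=T(\lambda)^x\quad(x\in\mathbb Z),$$ and for finitely supported $f:\mathbb Z\to\mathbb C^2$ put $\widehat f(\zeta)=\sum_{x}F_{\zeta}(x)^*f(x)$ for $\zeta\in S^1=\{\zeta\in\mathbb C:|\zeta|=1\}$. Inner products are linear in the first variable. Then: 1.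 $\sigma(U)=\{\zeta\in S^1 : |\mathrm{Re}\,\zeta|\le|\alpha|\}$. 2. There is exactly one positive-semidefinite-$2\times2$-matrix-valued Borel measure $\Sigma$ on $S^1$ such that $$\langle (U-\lambda)^{-1}f,g\rangle=\int_{S^1}\frac1{\zeta-\lambda}\,\langle d\Sigma(\zeta)\widehat f(\zeta),\widehat g(\zeta)\rangle_{\mathbb C^2}$$ for all $\lambda\in\mathbb C\setminus\sigma(U)$ and all finitely supported $f,g:\mathbb Z\to\mathbb C^2$. This $\Sigma$ is absolutely continuous with respect to the Lebesgue measure $\bar d\zeta$ on $S^1$ of total mass one, and it has the (integrable) density $$\frac{d\Sigma(\zeta)}{\bar d\zeta}=\frac{\chi_{\sigma(U)}(\zeta)}{\sqrt{|\alpha|^2-(\mathrm{Re}\,\zeta)^2}}\begin{bmatrix}|\mathrm{Im}\,\zeta|&-i\,\mathrm{sgn}(\mathrm{Im}\,\zeta)\,\frac{\beta}{\alpha}\,\mathrm{Re}\,\zeta\\ i\,\mathrm{sgn}(\mathrm{Im}\,\zeta)\,\frac{\overline\beta}{\overline\alpha}\,\mathrm{Re}\,\zeta&|\mathrm{Im}\,\zeta|\end{bmatrix},$$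 where $\chi_{\sigma(U)}$ is the characteristic function of $\sigma(U)$. -/

import Mathlib

open MeasureTheory
open scoped ComplexConjugate ComplexOrder Matrix

noncomputable section

namespace QuantumWalk

/-- `ℂ²` with its standard Hermitian inner product; `e_L` is the coordinate `0`, `e_R` the
coordinate `1`. -/
abbrev C2 : Type := EuclideanSpace ℂ (Fin 2)

/-- A `2 × 2` matrix acting on `ℂ²`. -/
def act (M : Matrix (Fin 2) (Fin 2) ℂ) (u : C2) : C2 := WithLp.toLp 2 (M *ᵥ WithLp.ofLp u)

/-- The Hilbert space `ℓ²(ℤ, ℂ²)`. -/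
abbrev L2Z : Type := lp (fun _ : ℤ => C2) 2

/-- A coin matrix, i.e. a map `ℤ → U(2)`. -/
abbrev Coin : Type := ℤ → Matrix.unitaryGroup (Fin 2) ℂ

/-- The orthogonal projection onto `ℂ e_L`. -/
def projL : Matrix (Fin 2) (Fin 2) ℂ := !![1, 0; 0, 0]

/-- The orthogonal projection onto `ℂ e_R`. -/
def projR : Matrix (Fin 2) (Fin 2) ℂ := !![0, 0; 0, 1]

/-- The quantum walk on all maps `ℤ → ℂ²`:
`(U Ψ)(x) = π_L C(x+1) Ψ(x+1) + π_R C(x-1) Ψ(x-1)`. -/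
def walkMap (𝒞 : Coin) (Ψ : ℤ → C2) (x : ℤ) : C2 :=
  act (projL * (𝒞 (x + 1) : Matrix (Fin 2) (Fin 2) ℂ)) (Ψ (x + 1)) +
    act (projR * (𝒞 (x - 1) : Matrix (Fin 2) (Fin 2) ℂ)) (Ψ (x - 1))

lemma norm_act_unitary (C : Matrix.unitaryGroup (Fin 2) ℂ) (u : C2) :
    ‖act (C : Matrix (Fin 2) (Fin 2) ℂ) u‖ = ‖u‖ := by
  have h : star (Matrix.toEuclideanCLM (n := Fin 2) (𝕜 := ℂ) (C : Matrix (Fin 2) (Fin 2) ℂ)) *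
      Matrix.toEuclideanCLM (n := Fin 2) (𝕜 := ℂ) (C : Matrix (Fin 2) (Fin 2) ℂ) = 1 := by
    rw [← map_star, ← map_mul, Matrix.UnitaryGroup.star_mul_self, map_one]
  exact (ContinuousLinearMap.norm_map_iff_adjoint_comp_self
    (Matrix.toEuclideanCLM (n := Fin 2) (𝕜 := ℂ) (C : Matrix (Fin 2) (Fin 2) ℂ))).2 h u

lemma norm_sq_C2 (u : C2) : ‖u‖ ^ 2 = ‖u 0‖ ^ 2 + ‖u 1‖ ^ 2 := by
  rw [EuclideanSpace.norm_sq_eq, Fin.sum_univ_two]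

lemma norm_sq_walkMap_le (𝒞 : Coin) (Ψ : ℤ → C2) (x : ℤ) :
    ‖walkMap 𝒞 Ψ x‖ ^ 2 ≤ ‖Ψ (x + 1)‖ ^ 2 + ‖Ψ (x - 1)‖ ^ 2 := by
  have h0 : walkMap 𝒞 Ψ x 0 =
      act (𝒞 (x + 1) : Matrix (Fin 2) (Fin 2) ℂ) (Ψ (x + 1)) 0 := by
    simp [walkMap, act, projL, projR, Matrix.vecMul, dotProduct, Fin.sum_univ_two]
  have h1 : walkMap 𝒞 Ψ x 1 =
      act (𝒞 (x - 1) : Matrix (Fin 2) (Fin 2) ℂ) (Ψ (x - 1)) 1 := by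
    simp [walkMap, act, projL, projR, Matrix.vecMul, dotProduct, Fin.sum_univ_two]
  rw [norm_sq_C2, h0, h1, ← norm_act_unitary (𝒞 (x + 1)) (Ψ (x + 1)),
    ← norm_act_unitary (𝒞 (x - 1)) (Ψ (x - 1)), norm_sq_C2 (act _ (Ψ (x + 1))),
    norm_sq_C2 (act _ (Ψ (x - 1)))]
  nlinarith [sq_nonneg ‖act (𝒞 (x + 1) : Matrix (Fin 2) (Fin 2) ℂ) (Ψ (x + 1)) 1‖,
    sq_nonneg ‖act (𝒞 (x - 1) : Matrix (Fin 2) (Fin 2) ℂ) (Ψ (x - 1)) 0‖]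

lemma summable_norm_sq (Ψ : L2Z) : Summable fun x : ℤ => ‖Ψ x‖ ^ 2 := by
  simpa using (memℓp_gen_iff (p := 2) (by simp)).1 (lp.memℓp Ψ)

lemma norm_sq_eq_tsum (Ψ : L2Z) : ‖Ψ‖ ^ 2 = ∑' x : ℤ, ‖Ψ x‖ ^ 2 := by
  simpa using lp.norm_rpow_eq_tsum (p := 2) (by simp) Ψ

lemma summable_shifts (Ψ : L2Z) :
    Summable fun x : ℤ => ‖Ψ (x + 1)‖ ^ 2 + ‖Ψ (x - 1)‖ ^ 2 :=
  ((Equiv.addRight (1 : ℤ)).summable_iff.2 (summable_norm_sq Ψ)).add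
    ((Equiv.subRight (1 : ℤ)).summable_iff.2 (summable_norm_sq Ψ))

lemma memℓp_walkMap (𝒞 : Coin) (Ψ : L2Z) : Memℓp (walkMap 𝒞 Ψ) 2 := by
  refine (memℓp_gen_iff (p := 2) (by simp)).2 ?_
  simpa using (summable_shifts Ψ).of_nonneg_of_le (fun x => sq_nonneg _)
    (norm_sq_walkMap_le 𝒞 Ψ)

lemma act_add (M : Matrix (Fin 2) (Fin 2) ℂ) (u v : C2) : act M (u + v) = act M u + act M v := by
  rw [act, WithLp.ofLp_add, Matrix.mulVec_add, WithLp.toLp_add]; rfl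

lemma act_smul (M : Matrix (Fin 2) (Fin 2) ℂ) (c : ℂ) (u : C2) :
    act M (c • u) = c • act M u := by
  rw [act, WithLp.ofLp_smul, Matrix.mulVec_smul, WithLp.toLp_smul]; rfl

/-- The quantum walk `U` with coin `𝒞` as a bounded operator on `ℓ²(ℤ, ℂ²)`. -/
def walk (𝒞 : Coin) : L2Z →L[ℂ] L2Z :=
  LinearMap.mkContinuous
    { toFun := fun Ψ => ⟨walkMap 𝒞 Ψ, memℓp_walkMap 𝒞 Ψ⟩
      map_add' := fun Ψ Φ => by
        ext1; funext x
        change walkMap 𝒞 (fun y => Ψ y + Φ y) x = walkMap 𝒞 Ψ x + walkMap 𝒞 Φ x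
        simp only [walkMap, act_add]
        abel
      map_smul' := fun c Ψ => by
        ext1; funext x
        change walkMap 𝒞 (fun y => c • Ψ y) x = c • walkMap 𝒞 Ψ x
        simp only [walkMap, act_smul, smul_add] }
    2 (fun Ψ => by
      refine le_of_sq_le_sq ?_ (by positivity)
      rw [norm_sq_eq_tsum, mul_pow, norm_sq_eq_tsum]
      have e1 := (Equiv.addRight (1 : ℤ)).tsum_eq (fun x => ‖Ψ x‖ ^ 2)
      have e2 := (Equiv.subRight (1 : ℤ)).tsum_eq (fun x => ‖Ψ x‖ ^ 2)
      have s1 := (Equiv.addRight (1 : ℤ)).summable_iff.2 (summable_norm_sq Ψ)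
      have s2 := (Equiv.subRight (1 : ℤ)).summable_iff.2 (summable_norm_sq Ψ)
      have hle : ∑' x : ℤ, ‖walkMap 𝒞 Ψ x‖ ^ 2 ≤
          ∑' x : ℤ, (‖Ψ (x + 1)‖ ^ 2 + ‖Ψ (x - 1)‖ ^ 2) :=
        ((summable_shifts Ψ).of_nonneg_of_le (fun x => sq_nonneg _)
          (norm_sq_walkMap_le 𝒞 Ψ)).tsum_le_tsum (norm_sq_walkMap_le 𝒞 Ψ) (summable_shifts Ψ)
      have hadd : ∑' x : ℤ, (‖Ψ (x + 1)‖ ^ 2 + ‖Ψ (x - 1)‖ ^ 2) =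
          ∑' x : ℤ, ‖Ψ x‖ ^ 2 + ∑' x : ℤ, ‖Ψ x‖ ^ 2 := by
        nth_rewrite 1 [← e1]
        rw [← e2]
        exact s1.tsum_add s2
      have hnn : 0 ≤ ∑' x : ℤ, ‖Ψ x‖ ^ 2 := tsum_nonneg fun x => sq_nonneg _
      change ∑' x : ℤ, ‖walkMap 𝒞 Ψ x‖ ^ 2 ≤ _
      linarith)

/-- The resolvent `R(λ) = (U - λ)⁻¹`, the inverse being taken in the algebra of bounded operators
(it is the genuine inverse for `λ` outside the spectrum). -/
def walkResolvent (𝒞 : Coin) (l : ℂ) : L2Z →L[ℂ] L2Z :=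
  Ring.inverse (walk 𝒞 - algebraMap ℂ (L2Z →L[ℂ] L2Z) l)

/-- The transfer matrix `T_λ(x)`, where `C(x)` has the entries `a_x, b_x; c_x, d_x`. -/
def transfer (𝒞 : Coin) (l : ℂ) (x : ℤ) : Matrix (Fin 2) (Fin 2) ℂ :=
  !![(l - l⁻¹ * 𝒞 x 1 0 * 𝒞 (x + 1) 0 1) / 𝒞 (x + 1) 0 0,
      -(l⁻¹ * (𝒞 (x + 1) 0 1 * 𝒞 x 1 1 / 𝒞 (x + 1) 0 0));
    l⁻¹ * 𝒞 x 1 0, l⁻¹ * 𝒞 x 1 1]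

/-- `T_λ(n-1) ⋯ T_λ(1) T_λ(0)`. -/
def transferProdPos (𝒞 : Coin) (l : ℂ) : ℕ → Matrix (Fin 2) (Fin 2) ℂ
  | 0 => 1
  | n + 1 => transfer 𝒞 l n * transferProdPos 𝒞 l n

/-- `T_λ(-n)⁻¹ ⋯ T_λ(-2)⁻¹ T_λ(-1)⁻¹`. -/
def transferProdNeg (𝒞 : Coin) (l : ℂ) : ℕ → Matrix (Fin 2) (Fin 2) ℂ
  | 0 => 1
  | n + 1 => (transfer 𝒞 l (-((n : ℤ) + 1)))⁻¹ * transferProdNeg 𝒞 l n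

/-- The matrix `F_λ(x)`, `x ∈ ℤ`. -/
def fundMatrix (𝒞 : Coin) (l : ℂ) (x : ℤ) : Matrix (Fin 2) (Fin 2) ℂ :=
  if 0 ≤ x then transferProdPos 𝒞 l x.toNat else transferProdNeg 𝒞 l (-x).toNat

/-- The QW-Fourier transform `∑ₓ F_{λ*}(x)* f(x)`, `λ* = 1 / conj λ`, of a finitely supported
function `f : ℤ → ℂ²`. -/
def qwFourier (𝒞 : Coin) (f : ℤ →₀ C2) (l : ℂ) : C2 :=
  f.sum fun x u => act (fundMatrix 𝒞 (conj l)⁻¹ x)ᴴ u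

/-- A finitely supported function as an element of `ℓ²(ℤ, ℂ²)`. -/
def toL2 (f : ℤ →₀ C2) : L2Z := f.sum fun x u => lp.single 2 x u

instance instMeasurableSpaceCircle : MeasurableSpace Circle := borel Circle

instance instBorelSpaceCircle : BorelSpace Circle := ⟨rfl⟩

/-- The Lebesgue measure on the unit circle with total mass one. -/
def circleLebesgue : Measure Circle :=
  ENNReal.ofReal (2 * Real.pi)⁻¹ •
    (volume.restrict (Set.Ioc (-Real.pi) Real.pi)).map Circle.exp

/-- `2 × 2`-matrix-valued (countably additive) Borel measures on the unit circle. -/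
abbrev MatrixMeasure : Type := VectorMeasure Circle (Matrix (Fin 2) (Fin 2) ℂ)

/-- The `(i, j)` entry of a matrix-valued measure, a complex measure. -/
def entry (S : MatrixMeasure) (i j : Fin 2) : ComplexMeasure Circle :=
  S.mapRange (Matrix.entryAddMonoidHom ℂ i j) (continuous_id.matrix_elem i j)

/-- `S` is positive: it takes values in the positive semidefinite Hermitian matrices. -/
def IsPositive (S : MatrixMeasure) : Prop :=
  ∀ A : Set Circle, MeasurableSet A → (S A).PosSemidef

/-- `∫ h(ζ) ⟨dS(ζ) k(ζ), l(ζ)⟩`, i.e. `∑ᵢⱼ ∫ h(ζ) kⱼ(ζ) conj (lᵢ(ζ)) dSᵢⱼ(ζ)`. -/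
def pairing (S : MatrixMeasure) (h : Circle → ℂ) (k l : Circle → C2) : ℂ :=
  ∑ i, ∑ j, (entry S i j).integral (fun ζ => h ζ * k ζ j * conj (l ζ i))
    (ContinuousLinearMap.mul ℝ ℂ)

/-- `S` is a positive-matrix-valued measure representing the resolvent of the walk:
`⟨R(λ) f, g⟩ = ∫ (ζ - λ)⁻¹ ⟨dS(ζ) f^(ζ), g^(ζ)⟩` for all finitely supported `f`, `g` and all `λ`
outside the spectrum of the walk, where `f^`, `g^` are the QW-Fourier transforms.
Here `⟨·, ·⟩` is linear in the first variable, whereas `inner` is linear in the second. -/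
def IsSpectralMatrixMeasure (𝒞 : Coin) (S : MatrixMeasure) : Prop :=
  IsPositive S ∧
    ∀ l : ℂ, l ∉ spectrum ℂ (walk 𝒞) → ∀ f g : ℤ →₀ C2,
      inner ℂ (toL2 g) (walkResolvent 𝒞 l (toL2 f)) =
        pairing S (fun ζ => ((ζ : ℂ) - l)⁻¹)
          (fun ζ => qwFourier 𝒞 f (ζ : ℂ)) (fun ζ => qwFourier 𝒞 g (ζ : ℂ))

/-- The constant coin `C(x) = C` for `C ∈ SU(2)`. -/
def constCoin (C : Matrix.specialUnitaryGroup (Fin 2) ℂ) : Coin :=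
  fun _ => ⟨C, C.2.1⟩

/-- The matrix
`(|α|² - (Re ζ)²)^(-1/2) [|Im ζ|, -i sgn(Im ζ) (β/α) Re ζ; i sgn(Im ζ) (conj β/conj α) Re ζ, |Im ζ|]`
(only used where `|Re ζ| ≤ |α|`). -/
def homogeneousDensity (α β : ℂ) (ζ : Circle) : Matrix (Fin 2) (Fin 2) ℂ :=
  (((Real.sqrt (‖α‖ ^ 2 - (ζ : ℂ).re ^ 2))⁻¹ : ℝ) : ℂ) •
    !![((|(ζ : ℂ).im| : ℝ) : ℂ),
        -(Complex.I * (Real.sign (ζ : ℂ).im : ℂ) * (β / α) * ((ζ : ℂ).re : ℂ));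
      Complex.I * (Real.sign (ζ : ℂ).im : ℂ) * (conj β / conj α) * ((ζ : ℂ).re : ℂ),
        ((|(ζ : ℂ).im| : ℝ) : ℂ)]

end QuantumWalk

end

/-!
The walk is diagonalized by the dual transfer matrices `A(ζ) = T(ζ)ᴴ`, `|ζ| = 1`. The identity
`dualTransfer_eigen` says that `A(ζ) ^ (x - 1) π_L C + A(ζ) ^ (x + 1) π_R C = ζ A(ζ) ^ x`, so that
the transform `f ↦ ∑ₓ A(ζ) ^ x f(x)`, which is the QW-Fourier transform, turns the walk into the
multiplication by `ζ` (`fourier_step`).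

Everything then rests on the Plancherel formula `⟨f, g⟩ = ∫ ⟨ρ f^, g^⟩` for the density `ρ` of the
theorem (`spectralForm_fourier`). Since `Aᴴ ρ A = ρ`, the product `(A ^ y)ᴴ ρ A ^ x` only depends on
`n = x - y`, and the formula reduces to `∫ ρ A ^ n = δ_{n,0}` (`integral_density_mul_zpow`). To
compute this integral, substitute `ζ = exp (± i ω)`, `cos ω = |α| cos k` with `0 < k < π`: the
weight `dω / √(|α|² - cos² ω)` becomes `dk / √(1 - |α|² cos² k)`, and by Cayley-Hamilton for `A` the
sum of the contributions of `ζ` and of its conjugate is a constant times `cos (n k)` times the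
identity matrix.

The Plancherel formula shows that the walk `U` is unitary, and that `U - λ` is bounded below by the
distance of `λ` to the arcs `|Re ζ| ≤ |α|`; being normal, it is invertible off the arcs. On the arcs
the equation `U Ψ = λ Ψ` has plane wave solutions, whose truncations are approximate eigenvectors.
This gives the spectrum (`spectrum_walk`).

Off the spectrum, `∫ (ζ - λ)⁻¹ ⟨ρ f^, g^⟩` and `⟨(U - λ)⁻¹ f, g⟩` agree for `f` in the dense range
of `U - λ`, by the Plancherel formula, and both are continuous in `f` by the Cauchy-Schwarz
inequality for `ρ ≥ 0`; so they agree everywhere (`inner_walkResolvent`). For the uniqueness, take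
`f` and `g` supported at the origin, where `F_ζ(0) = 1`: the Cauchy transforms of the matrix entries
off the unit circle are determined, and the expansions of a Cauchy transform at `0` and at `∞`
contain all Fourier coefficients of the measure (`eq_zero_of_cauchyTransform_eq_zero`).
-/

noncomputable section

namespace QuantumWalk

/-! ### Complex measures and Cauchy transforms on the circle -/

section ComplexMeasures

open Filter Topology VectorMeasure

variable {X : Type*} [MeasurableSpace X]

/-- Integration against the complex measure `ρ μ` is integration of `g ρ` against `μ`. -/
lemma integral_withDensityᵥ_mul {μ : Measure X} {ρ g : X → ℂ} (hρ : Integrable ρ μ)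
    (hg : AEStronglyMeasurable g μ) (hgρ : Integrable (fun x => g x * ρ x) μ) :
    (μ.withDensityᵥ ρ).integral g (ContinuousLinearMap.mul ℝ ℂ) = ∫ x, g x * ρ x ∂μ := by
  have hvar := Measure.variation_withDensityᵥ hρ
  have hfin : ∀ᵐ x ∂μ, ‖ρ x‖ₑ < ⊤ := by simp
  have hm : AEMeasurable (fun x => ‖ρ x‖ₑ) μ := hρ.aestronglyMeasurable.enorm
  have : IsFiniteMeasure (μ.withDensityᵥ ρ).variation := by
    rw [hvar]; exact ⟨by simpa using! hρ.2⟩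
  have hac : (μ.withDensityᵥ ρ).variation ≪ μ := by
    rw [hvar]; exact withDensity_absolutelyContinuous _ _
  -- integrability against the variation `|ρ| μ` is integrability of the product with `ρ`
  have key : ∀ f : X → ℂ, Integrable f (μ.withDensityᵥ ρ).variation →
      Integrable (fun x => f x * ρ x) μ := by
    intro f hf
    rw [hvar, integrable_withDensity_iff_integrable_smul₀' hm hfin] at hf
    have h1 : AEStronglyMeasurable (fun x => f x * ρ x) μ := by
      have h2 : AEStronglyMeasurable
          (fun x => (‖ρ x‖ₑ.toReal • f x) * ((‖ρ x‖⁻¹ : ℝ) • ρ x)) μ :=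
        hf.aestronglyMeasurable.mul
          (hρ.aestronglyMeasurable.norm.inv₀.smul hρ.aestronglyMeasurable)
      refine h2.congr (Eventually.of_forall fun x => ?_)
      rcases eq_or_ne (ρ x) 0 with h | h
      · simp [h]
      · have : ((‖ρ x‖ : ℝ) : ℂ) ≠ 0 := by simpa using h
        simp only [toReal_enorm, Complex.real_smul, Complex.ofReal_inv]
        field_simp
    refine hf.mono h1 (Eventually.of_forall fun x => ?_)
    simp [mul_comm]
  have hint : Integrable g (μ.withDensityᵥ ρ).variation := by
    rw [hvar, integrable_withDensity_iff_integrable_smul₀' hm hfin]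
    refine hgρ.mono (hm.ennreal_toReal.aestronglyMeasurable.smul hg)
      (Eventually.of_forall fun x => ?_)
    simp [mul_comm]
  refine Integrable.induction (μ := (μ.withDensityᵥ ρ).variation)
    (P := fun f => (μ.withDensityᵥ ρ).integral f (ContinuousLinearMap.mul ℝ ℂ) =
      ∫ x, f x * ρ x ∂μ) ?_ ?_ ?_ ?_ hint
  · intro c s hs _
    have : (fun x => s.indicator (fun _ => c) x * ρ x) = s.indicator fun x => c * ρ x := by
      ext x; by_cases hx : x ∈ s <;> simp [hx]
    have e := VectorMeasure.integral_indicator_const (μ := μ.withDensityᵥ ρ)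
      (B := ContinuousLinearMap.mul ℝ ℂ) c hs
    rw [e, this, MeasureTheory.integral_indicator hs,
      withDensityᵥ_apply hρ hs]
    simp [MeasureTheory.integral_const_mul]
  · intro f h _ hf hh ihf ihh
    rw [VectorMeasure.integral_add hf hh, ihf, ihh,
      ← MeasureTheory.integral_add (key f hf) (key h hh)]
    simp [add_mul]
  · refine isClosed_eq continuous_integral ?_
    have : LipschitzWith 1 fun f : X →₁[(μ.withDensityᵥ ρ).variation] ℂ =>
        ∫ x, f x * ρ x ∂μ := by
      refine LipschitzWith.of_dist_le_mul fun f h => ?_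
      have hf := L1.integrable_coeFn f
      have hh := L1.integrable_coeFn h
      rw [dist_eq_norm, dist_eq_norm, ← MeasureTheory.integral_sub (key _ hf) (key _ hh)]
      refine (norm_integral_le_integral_norm _).trans ?_
      rw [NNReal.coe_one, one_mul, L1.norm_eq_integral_norm]
      have e1 : ∫ x, ‖(f - h : X →₁[(μ.withDensityᵥ ρ).variation] ℂ) x‖
          ∂(μ.withDensityᵥ ρ).variation =
          ∫ x, ‖f x - h x‖ ∂(μ.withDensityᵥ ρ).variation := by
        refine MeasureTheory.integral_congr_ae ?_
        filter_upwards [Lp.coeFn_sub f h] with x hx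
        rw [hx]; rfl
      have e2 : ∀ F : X → ℝ, ∫ x, F x ∂(μ.withDensityᵥ ρ).variation =
          ∫ x, ‖ρ x‖ₑ.toReal • F x ∂μ := fun F => by
        rw [hvar, integral_withDensity_eq_integral_toReal_smul₀ hm hfin]
      rw [e1, e2]
      refine le_of_eq (MeasureTheory.integral_congr_ae (Eventually.of_forall fun x => ?_))
      beta_reduce
      rw [← sub_mul, norm_mul, toReal_enorm, smul_eq_mul, mul_comm]
    exact this.continuous
  · intro f h hfh hf ih
    rw [← VectorMeasure.integral_congr_ae hfh, ih]
    refine MeasureTheory.integral_congr_ae ?_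
    rw [hvar] at hfh
    have := (ae_withDensity_iff' hm).1 hfh
    filter_upwards [this] with x hx
    rcases eq_or_ne (ρ x) 0 with h0 | h0
    · simp [h0]
    · rw [hx (by simpa using h0)]

lemma integral_const_mul_complexMeasure (c : ComplexMeasure X) (a : ℂ) (f : X → ℂ) :
    c.integral (fun x => a * f x) (ContinuousLinearMap.mul ℝ ℂ) =
      a * c.integral f (ContinuousLinearMap.mul ℝ ℂ) := by
  refine setToFun_smul _ (fun b s x => ?_) a f
  simp only [VectorMeasure.transpose, smul_eq_mul]
  exact mul_assoc b x (c s)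

instance isFiniteMeasure_variation (c : ComplexMeasure X) : IsFiniteMeasure c.variation := by
  have hs : ∀ s : SignedMeasure X, IsFiniteMeasure s.variation := fun s => by
    rw [← SignedMeasure.totalVariation_eq_variation]; infer_instance
  have := hs (ComplexMeasure.re c)
  have := hs (ComplexMeasure.im c)
  refine isFiniteMeasure_of_le
    ((ComplexMeasure.re c).variation + (ComplexMeasure.im c).variation)
    (variation_le_of_forall_enorm_le fun E _ => ?_)
  have h1 : ‖c E‖ₑ ≤ ‖ComplexMeasure.re c E‖ₑ + ‖ComplexMeasure.im c E‖ₑ := by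
    have h2 : ‖c E‖ ≤ ‖(c E).re‖ + ‖(c E).im‖ := by
      simpa using Complex.norm_le_abs_re_add_abs_im (c E)
    simp only [← ofReal_norm, ComplexMeasure.re_apply, ComplexMeasure.im_apply]
    rw [← ENNReal.ofReal_add (norm_nonneg _) (norm_nonneg _)]
    exact ENNReal.ofReal_le_ofReal h2
  exact h1.trans (add_le_add (enorm_measure_le_variation _ _) (enorm_measure_le_variation _ _))

lemma integrable_variation_of_continuous [TopologicalSpace X] [CompactSpace X] [BorelSpace X]
    [SecondCountableTopologyEither X ℂ] (c : ComplexMeasure X) {f : X → ℂ} (hf : Continuous f) :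
    Integrable f c.variation := by
  obtain ⟨C, hC⟩ := isCompact_univ.exists_bound_of_continuousOn hf.continuousOn
  exact Integrable.of_bound hf.aestronglyMeasurable C (Eventually.of_forall fun x => hC x trivial)

/-- A complex Borel measure on a compact metric space that annihilates all continuous functions
vanishes: closed sets are limits of continuous functions, and generate the Borel sets. -/
lemma eq_zero_of_forall_integral_continuous [PseudoEMetricSpace X] [CompactSpace X] [BorelSpace X]
    (c : ComplexMeasure X)
    (h : ∀ f : C(X, ℂ), c.integral f (ContinuousLinearMap.mul ℝ ℂ) = 0) : c = 0 := by
  have hclosed : ∀ F : Set X, IsClosed F → c F = 0 := by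
    intro F hF
    have hpos : ∀ n : ℕ, (0 : ℝ) < 1 / (n + 1) := fun n => by positivity
    have hlim : Tendsto (fun n : ℕ => c.integral
        (fun x => ((thickenedIndicator (hpos n) F x : ℝ) : ℂ)) (ContinuousLinearMap.mul ℝ ℂ))
        atTop (𝓝 (c.integral (F.indicator fun _ => (1 : ℂ)) (ContinuousLinearMap.mul ℝ ℂ))) := by
      refine tendsto_integral_of_dominated_convergence (fun _ => 1) (fun n => ?_)
        (integrable_const _) (fun n => Eventually.of_forall fun x => ?_)
        (Eventually.of_forall fun x => ?_)
      · have : Continuous fun x => ((thickenedIndicator (hpos n) F x : ℝ) : ℂ) := by fun_prop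
        exact this.aestronglyMeasurable
      · simpa using thickenedIndicator_le_one (hpos n) F x
      · have h1 := thickenedIndicator_tendsto_indicator_closure hpos
          tendsto_one_div_add_atTop_nhds_zero_nat F
        rw [tendsto_pi_nhds] at h1
        have h2 := ((Complex.continuous_ofReal.comp NNReal.continuous_coe).tendsto _).comp (h1 x)
        rw [hF.closure_eq] at h2
        refine h2.congr' (Eventually.of_forall fun n => rfl) |>.trans (le_of_eq ?_)
        by_cases hx : x ∈ F <;> simp [hx]
    have hzero : ∀ n : ℕ, c.integral
        (fun x => ((thickenedIndicator (hpos n) F x : ℝ) : ℂ)) (ContinuousLinearMap.mul ℝ ℂ)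
        = 0 := fun n => h ⟨fun x => ((thickenedIndicator (hpos n) F x : ℝ) : ℂ), by fun_prop⟩
    simp only [hzero] at hlim
    have := tendsto_nhds_unique hlim tendsto_const_nhds
    rw [VectorMeasure.integral_indicator_const _ hF.measurableSet] at this
    simpa using this
  have huniv : c Set.univ = 0 := hclosed _ isClosed_univ
  refine VectorMeasure.ext fun s hs => ?_
  rw [zero_apply]
  refine MeasurableSpace.induction_on_inter (C := fun s _ => c s = 0)
    (borel_eq_generateFrom_isClosed (α := X) ▸ BorelSpace.measurable_eq) isPiSystem_isClosed
    c.empty hclosed (fun t ht h0 => ?_) (fun f hd hf h0 => ?_) s hs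
  · have := VectorMeasure.of_add_of_sdiff (v := c) ht MeasurableSet.univ (Set.subset_univ t)
    rw [h0, huniv, zero_add] at this
    rwa [Set.compl_eq_univ_sdiff]
  · have := c.m_iUnion hf hd
    simp only [h0] at this
    exact this.unique hasSum_zero

/-- If the generating function `∑ mᵏ ∫ g wᵏ` of the moments of a complex measure vanishes for small
`m ≠ 0`, so do the moments: they are recovered one by one by letting `m → 0`. -/
lemma integral_mul_pow_eq_zero [TopologicalSpace X] [CompactSpace X] [BorelSpace X]
    [SecondCountableTopologyEither X ℂ] (c : ComplexMeasure X) {g w : X → ℂ} (hg : Continuous g)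
    (hw : Continuous w) (hw1 : ∀ x, ‖w x‖ ≤ 1)
    (h : ∀ m : ℂ, m ≠ 0 → ‖m‖ < 1 →
      c.integral (fun x => g x * (1 - m * w x)⁻¹) (ContinuousLinearMap.mul ℝ ℂ) = 0) (k : ℕ) :
    c.integral (fun x => g x * w x ^ k) (ContinuousLinearMap.mul ℝ ℂ) = 0 := by
  have hlt : ∀ m : ℂ, ‖m‖ < 1 → ∀ x, ‖m * w x‖ < 1 := fun m hm x => by
    rw [norm_mul]; nlinarith [norm_nonneg m, norm_nonneg (w x), hw1 x]
  have hne : ∀ m : ℂ, ‖m‖ < 1 → ∀ x, 1 - m * w x ≠ 0 := fun m hm x h0 => by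
    have := hlt m hm x
    rw [← sub_eq_zero.1 h0] at this
    simp at this
  have hcont : ∀ (k : ℕ) (m : ℂ), ‖m‖ < 1 →
      Continuous fun x => g x * w x ^ k * (1 - m * w x)⁻¹ := fun k m hm =>
    (hg.mul (hw.pow k)).mul ((continuous_const.sub (continuous_const.mul hw)).inv₀ (hne m hm))
  -- the step from the generating function shifted by `k` to the `k`-th moment
  have step : ∀ k : ℕ, (∀ m : ℂ, m ≠ 0 → ‖m‖ < 1 →
      c.integral (fun x => g x * w x ^ k * (1 - m * w x)⁻¹) (ContinuousLinearMap.mul ℝ ℂ) = 0) →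
      c.integral (fun x => g x * w x ^ k) (ContinuousLinearMap.mul ℝ ℂ) = 0 := by
    intro k hk
    obtain ⟨C, hC⟩ := isCompact_univ.exists_bound_of_continuousOn
      ((hg.mul (hw.pow k)).continuousOn (s := Set.univ))
    have hsmall : ∀ n : ℕ, ‖((1 / ((n : ℝ) + 2) : ℝ) : ℂ)‖ ≤ 1 / 2 := fun n => by
      rw [Complex.norm_real, Real.norm_of_nonneg (by positivity)]
      exact one_div_le_one_div_of_le (by norm_num) (by linarith [(Nat.cast_nonneg n : (0:ℝ) ≤ n)])
    have hlim : Tendsto (fun n : ℕ => c.integral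
        (fun x => g x * w x ^ k * (1 - ((1 / ((n : ℝ) + 2) : ℝ) : ℂ) * w x)⁻¹)
        (ContinuousLinearMap.mul ℝ ℂ)) atTop
        (𝓝 (c.integral (fun x => g x * w x ^ k) (ContinuousLinearMap.mul ℝ ℂ))) := by
      refine tendsto_integral_of_dominated_convergence (fun _ => C * 2)
        (fun n => (hcont k _ ((hsmall n).trans_lt (by norm_num))).aestronglyMeasurable)
        (integrable_const _) (fun n => Eventually.of_forall fun x => ?_)
        (Eventually.of_forall fun x => ?_)
      · rw [norm_mul]
        refine mul_le_mul (hC x trivial) ?_ (norm_nonneg _) ((norm_nonneg _).trans (hC x trivial))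
        rw [norm_inv]
        refine inv_le_of_inv_le₀ (by norm_num) ?_
        have h1 := norm_sub_norm_le (1 : ℂ) (((1 / ((n : ℝ) + 2) : ℝ) : ℂ) * w x)
        rw [norm_one, norm_mul] at h1
        have h2 := mul_le_mul (hsmall n) (hw1 x) (norm_nonneg _) (by norm_num)
        linarith
      · have h0 : Tendsto (fun n : ℕ => ((1 / ((n : ℝ) + 2) : ℝ) : ℂ)) atTop (𝓝 0) := by
          have h3 := (tendsto_const_div_atTop_nhds_zero_nat (1 : ℝ)).comp
            (tendsto_add_atTop_nat 2)
          have h4 := (Complex.continuous_ofReal.tendsto _).comp h3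
          rw [Complex.ofReal_zero] at h4
          refine h4.congr fun n => ?_
          simp
        have h5 : Tendsto (fun n : ℕ => g x * w x ^ k *
            (1 - ((1 / ((n : ℝ) + 2) : ℝ) : ℂ) * w x)⁻¹) atTop
            (𝓝 (g x * w x ^ k * (1 - 0 * w x)⁻¹)) :=
          ((tendsto_const_nhds.sub (h0.mul_const _)).inv₀ (by simp)).const_mul _
        simpa using h5
    have hz : ∀ n : ℕ, c.integral
        (fun x => g x * w x ^ k * (1 - ((1 / ((n : ℝ) + 2) : ℝ) : ℂ) * w x)⁻¹)
        (ContinuousLinearMap.mul ℝ ℂ) = 0 := fun n =>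
      hk _ (by rw [Complex.ofReal_ne_zero]; positivity) ((hsmall n).trans_lt (by norm_num))
    simp only [hz] at hlim
    exact tendsto_nhds_unique tendsto_const_nhds hlim |>.symm
  have all : ∀ k : ℕ, ∀ m : ℂ, m ≠ 0 → ‖m‖ < 1 →
      c.integral (fun x => g x * w x ^ k * (1 - m * w x)⁻¹) (ContinuousLinearMap.mul ℝ ℂ) = 0 := by
    intro k
    induction k with
    | zero => simpa using h
    | succ k ih =>
      intro m hm hm1
      have e : (fun x => g x * w x ^ (k + 1) * (1 - m * w x)⁻¹) =
          fun x => m⁻¹ * (g x * w x ^ k * (1 - m * w x)⁻¹ - g x * w x ^ k) := by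
        ext x
        have := hne m hm1 x
        field_simp
        ring
      have e2 := VectorMeasure.integral_sub (B := ContinuousLinearMap.mul ℝ ℂ)
        (integrable_variation_of_continuous c (hcont k m hm1))
        (integrable_variation_of_continuous c (f := fun x => g x * w x ^ k) (hg.mul (hw.pow k)))
      rw [ih m hm hm1, step k ih, sub_zero] at e2
      rw [e, integral_const_mul_complexMeasure]
      exact mul_eq_zero_of_right _ e2
  exact step k (all k)

lemma continuous_inv_coe_sub {l : ℂ} (hl : ‖l‖ ≠ 1) :
    Continuous fun ζ : Circle => ((ζ : ℂ) - l)⁻¹ := by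
  have h1 : Continuous fun ζ : Circle => (ζ : ℂ) - l :=
    Continuous.sub continuous_subtype_val continuous_const
  exact h1.inv₀ fun ζ h => hl (by rw [← sub_eq_zero.1 h, Circle.norm_coe])

/-- A complex measure on the unit circle whose Cauchy transform vanishes off the circle is zero:
the expansions of the transform at `0` and at `∞` contain all Fourier coefficients. -/
lemma eq_zero_of_cauchyTransform_eq_zero (c : ComplexMeasure Circle)
    (h : ∀ l : ℂ, ‖l‖ ≠ 1 →
      c.integral (fun ζ => ((ζ : ℂ) - l)⁻¹) (ContinuousLinearMap.mul ℝ ℂ) = 0) : c = 0 := by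
  have hcoe : Continuous fun ζ : Circle => (ζ : ℂ) := continuous_subtype_val
  have hinv : Continuous fun ζ : Circle => (ζ : ℂ)⁻¹ :=
    hcoe.inv₀ fun ζ => Circle.coe_ne_zero ζ
  have hpos : ∀ k : ℕ, c.integral (fun ζ => (ζ : ℂ) ^ k) (ContinuousLinearMap.mul ℝ ℂ) = 0 := by
    intro k
    have := integral_mul_pow_eq_zero c (g := fun _ => 1) continuous_const hcoe
      (fun ζ => (Circle.norm_coe ζ).le) (fun m hm hm1 => ?_) k
    · simpa using this
    · have e : (fun ζ : Circle => 1 * (1 - m * (ζ : ℂ))⁻¹) =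
          fun ζ : Circle => -m⁻¹ * ((ζ : ℂ) - m⁻¹)⁻¹ := by
        ext ζ
        rw [one_mul, ← inv_neg, ← mul_inv]
        congr 1
        field_simp
        ring
      rw [e, integral_const_mul_complexMeasure, h m⁻¹ ?_, mul_zero]
      rw [norm_inv]
      exact (one_lt_inv₀ (norm_pos_iff.2 hm) |>.2 hm1).ne'
  have hneg : ∀ k : ℕ, c.integral (fun ζ => (ζ : ℂ)⁻¹ ^ (k + 1))
      (ContinuousLinearMap.mul ℝ ℂ) = 0 := by
    intro k
    have := integral_mul_pow_eq_zero c (g := fun ζ : Circle => (ζ : ℂ)⁻¹) hinv hinv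
      (fun ζ => by rw [norm_inv, Circle.norm_coe, inv_one]) (fun m hm hm1 => ?_) k
    · simpa only [pow_succ'] using this
    · have e : (fun ζ : Circle => (ζ : ℂ)⁻¹ * (1 - m * (ζ : ℂ)⁻¹)⁻¹) =
          fun ζ : Circle => ((ζ : ℂ) - m)⁻¹ := by
        ext ζ
        have := Circle.coe_ne_zero ζ
        rw [← mul_inv, mul_sub, mul_one, mul_comm m, mul_inv_cancel_left₀ this]
      rw [e, h m hm1.ne]
  have hz : ∀ n : ℤ, c.integral (fun ζ => (ζ : ℂ) ^ n) (ContinuousLinearMap.mul ℝ ℂ) = 0 := by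
    intro n
    rcases n with k | k
    · simpa using hpos k
    · simpa using hneg k
  let N : Submodule ℂ C(Circle, ℂ) :=
    { carrier := {f | c.integral f (ContinuousLinearMap.mul ℝ ℂ) = 0}
      add_mem' := fun {f g} hf hg => by
        have := VectorMeasure.integral_add (B := ContinuousLinearMap.mul ℝ ℂ)
          (integrable_variation_of_continuous c f.continuous)
          (integrable_variation_of_continuous c g.continuous)
        rw [Set.mem_ofPred_eq] at hf hg ⊢
        rw [hf, hg, add_zero] at this
        exact this
      zero_mem' := VectorMeasure.integral_zero
      smul_mem' := fun a f hf => by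
        rw [Set.mem_ofPred_eq] at hf ⊢
        have := integral_const_mul_complexMeasure c a f
        rw [hf, mul_zero] at this
        exact this }
  have hN : IsClosed (N : Set C(Circle, ℂ)) := by
    refine isClosed_eq ?_ continuous_const
    refine continuous_iff_continuousAt.2 fun f => ?_
    refine continuousAt_of_dominated (bound := fun _ => ‖f‖ + 1)
      (Eventually.of_forall fun g => g.continuous.aestronglyMeasurable) ?_
      (integrable_const _) (Eventually.of_forall fun ζ => ?_)
    · filter_upwards [Metric.ball_mem_nhds f one_pos] with g hg
      refine Eventually.of_forall fun ζ => (g.norm_coe_le_norm ζ).trans ?_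
      have := norm_sub_norm_le g f
      rw [Metric.mem_ball, dist_eq_norm] at hg
      linarith
    · exact (continuous_eval_const ζ).continuousAt
  let z : C(Circle, ℂ) := ⟨fun ζ => (ζ : ℂ), hcoe⟩
  have hmon : ∀ f ∈ Submonoid.closure ({z} ∪ star {z} : Set C(Circle, ℂ)),
      ∃ n : ℤ, ∀ ζ : Circle, f ζ = (ζ : ℂ) ^ n := by
    intro f hf
    induction hf using Submonoid.closure_induction with
    | mem x hx =>
      rcases hx with hx | hx
      · exact ⟨1, fun ζ => by rw [Set.mem_singleton_iff.1 hx]; simp [z]⟩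
      · refine ⟨-1, fun ζ => ?_⟩
        have : x = star z := by rw [← Set.mem_singleton_iff.1 hx, star_star]
        rw [this, zpow_neg_one]
        exact (Circle.coe_inv_eq_conj ζ ▸ Circle.coe_inv ζ)
    | one => exact ⟨0, fun ζ => by simp⟩
    | mul x y _ _ hx hy =>
      obtain ⟨n, hn⟩ := hx
      obtain ⟨m, hm⟩ := hy
      exact ⟨n + m, fun ζ => by
        rw [ContinuousMap.mul_apply, hn, hm, zpow_add₀ (Circle.coe_ne_zero ζ)]⟩
  have hsub : ((StarAlgebra.adjoin ℂ {z} : StarSubalgebra ℂ C(Circle, ℂ)) :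
      Set C(Circle, ℂ)) ⊆ N := by
    intro f hf
    have hf' : f ∈ Submodule.span ℂ
        (Submonoid.closure ({z} ∪ star {z} : Set C(Circle, ℂ)) : Set C(Circle, ℂ)) := by
      rw [← StarAlgebra.adjoin_eq_span]; exact hf
    refine (Submodule.span_le.2 fun g hg => ?_) hf'
    obtain ⟨n, hn⟩ := hmon g hg
    have : (g : Circle → ℂ) = fun ζ : Circle => (ζ : ℂ) ^ n := funext hn
    change c.integral g _ = 0
    rw [this, hz]
  have hdense := ContinuousMap.starSubalgebra_topologicalClosure_eq_top_of_separatesPoints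
    (StarAlgebra.adjoin ℂ {z} : StarSubalgebra ℂ C(Circle, ℂ)) (fun x y hxy =>
      ⟨z, ⟨z, StarAlgebra.self_mem_adjoin_singleton ℂ z, rfl⟩, fun h => hxy (Circle.ext h)⟩)
  refine eq_zero_of_forall_integral_continuous c fun f => ?_
  have hf : f ∈ (StarAlgebra.adjoin ℂ {z} : StarSubalgebra ℂ C(Circle, ℂ)).topologicalClosure := by
    rw [hdense]; trivial
  exact closure_minimal hsub hN hf

end ComplexMeasures

/-! ### Integration over the arcs -/

section ArcIntegral

open Real Set

/-- The union of the two arcs `|Re ζ| ≤ a` of the unit circle. -/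
def arcs (a : ℝ) : Set Circle := {ζ | |(ζ : ℂ).re| ≤ a}

lemma isClosed_arcs (a : ℝ) : IsClosed (arcs a) :=
  isClosed_le (Complex.continuous_re.comp continuous_subtype_val).abs continuous_const

lemma sqrt_one_sub_pos {a : ℝ} (ha0 : 0 < a) (ha1 : a < 1) (k : ℝ) :
    0 < √(1 - a ^ 2) ∧ √(1 - a ^ 2) ≤ √(1 - (a * cos k) ^ 2) := by
  refine ⟨Real.sqrt_pos.2 (by nlinarith), Real.sqrt_le_sqrt ?_⟩
  nlinarith [Real.cos_sq_le_one k, sq_nonneg a]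

lemma abs_mul_cos_le {a : ℝ} (ha0 : 0 < a) (k : ℝ) : -a ≤ a * cos k ∧ a * cos k ≤ a := by
  constructor <;> nlinarith [Real.neg_one_le_cos k, Real.cos_le_one k]

/-- The quasi-energy `ω ∈ (0, π)` with `cos ω = a cos k`. -/
def quasiEnergy (a k : ℝ) : ℝ := arccos (a * cos k)

lemma cos_quasiEnergy {a : ℝ} (ha0 : 0 < a) (ha1 : a < 1) (k : ℝ) :
    cos (quasiEnergy a k) = a * cos k :=
  Real.cos_arccos (by linarith [(abs_mul_cos_le ha0 k).1]) (by linarith [(abs_mul_cos_le ha0 k).2])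

lemma sin_quasiEnergy (a k : ℝ) : sin (quasiEnergy a k) = √(1 - (a * cos k) ^ 2) :=
  Real.sin_arccos _

lemma image_quasiEnergy {a : ℝ} (ha0 : 0 < a) (ha1 : a < 1) :
    quasiEnergy a '' Ioo 0 π = {ω | ω ∈ Ioo 0 π ∧ |cos ω| < a} := by
  ext ω
  constructor
  · rintro ⟨k, hk, rfl⟩
    have hs := Real.sin_pos_of_mem_Ioo hk
    have hb := abs_mul_cos_le ha0 k
    refine ⟨⟨Real.arccos_pos.2 (by linarith), ?_⟩, ?_⟩
    · refine lt_of_le_of_ne (Real.arccos_le_pi _) fun h => ?_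
      have := Real.arccos_eq_pi.1 h
      linarith
    · rw [cos_quasiEnergy ha0 ha1, abs_lt]
      have : cos k ^ 2 < 1 := by nlinarith [Real.sin_sq_add_cos_sq k]
      obtain ⟨h1, h2⟩ := abs_lt.1 ((sq_lt_one_iff_abs_lt_one _).1 this)
      constructor <;> nlinarith
  · rintro ⟨hω, hc⟩
    obtain ⟨h1, h2⟩ := abs_lt.1 hc
    have e1 : -1 < cos ω / a := by rw [lt_div_iff₀ ha0]; linarith
    have e2 : cos ω / a < 1 := by rw [div_lt_iff₀ ha0]; linarith
    refine ⟨arccos (cos ω / a), ⟨Real.arccos_pos.2 e2, ?_⟩, ?_⟩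
    · refine lt_of_le_of_ne (Real.arccos_le_pi _) fun h => ?_
      have := Real.arccos_eq_pi.1 h
      linarith
    · rw [quasiEnergy, Real.cos_arccos e1.le e2.le, mul_div_cancel₀ _ ha0.ne',
        Real.arccos_cos hω.1.le hω.2.le]

lemma injOn_quasiEnergy {a : ℝ} (ha0 : 0 < a) (ha1 : a < 1) :
    InjOn (quasiEnergy a) (Ioo 0 π) := by
  intro k hk l hl h
  have := congrArg cos h
  rw [cos_quasiEnergy ha0 ha1, cos_quasiEnergy ha0 ha1] at this
  exact Real.injOn_cos ⟨hk.1.le, hk.2.le⟩ ⟨hl.1.le, hl.2.le⟩ (mul_left_cancel₀ ha0.ne' this)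

lemma hasDerivAt_quasiEnergy {a : ℝ} (ha0 : 0 < a) (ha1 : a < 1) (k : ℝ) :
    HasDerivAt (quasiEnergy a) (a * sin k * (√(1 - (a * cos k) ^ 2))⁻¹) k := by
  have hb := abs_mul_cos_le ha0 k
  have h := (Real.hasDerivAt_arccos (x := a * cos k) (by linarith) (by linarith)).comp k
    ((Real.hasDerivAt_cos k).const_mul a)
  refine h.congr_deriv ?_
  rw [one_div]; ring

lemma continuous_quasiEnergy (a : ℝ) : Continuous (quasiEnergy a) :=
  Real.continuous_arccos.comp (continuous_const.mul Real.continuous_cos)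

/-- The substitution `cos ω = a cos k`, under which the arcsine-type weight
`dω / √(a² - cos² ω)` becomes `dk / √(1 - a² cos² k)`. -/
lemma integral_arcsine_weight {a : ℝ} (ha0 : 0 < a) (ha1 : a < 1) {ψ : ℝ → ℂ}
    (hψ : Measurable ψ) {M : ℝ} (hM : ∀ ω, ‖ψ ω‖ ≤ M) :
    IntegrableOn ({ω | |cos ω| ≤ a}.indicator
        fun ω => (((√(a ^ 2 - cos ω ^ 2))⁻¹ : ℝ) : ℂ) * ψ ω) (Ioo 0 π) ∧
      ∫ ω in Ioo 0 π, {ω | |cos ω| ≤ a}.indicator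
        (fun ω => (((√(a ^ 2 - cos ω ^ 2))⁻¹ : ℝ) : ℂ) * ψ ω) ω =
      ∫ k in Ioo 0 π, (((√(1 - (a * cos k) ^ 2))⁻¹ : ℝ) : ℂ) * ψ (quasiEnergy a k) := by
  set H : ℝ → ℂ := fun ω => (((√(a ^ 2 - cos ω ^ 2))⁻¹ : ℝ) : ℂ) * ψ ω with hH
  have hE : MeasurableSet {ω : ℝ | ω ∈ Ioo 0 π ∧ |cos ω| < a} :=
    measurableSet_Ioo.inter (isOpen_lt Real.continuous_cos.abs continuous_const).measurableSet
  -- on the boundary of the arcs, the weight takes the value `0⁻¹ = 0`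
  have hind : EqOn ({ω | |cos ω| ≤ a}.indicator H)
      ({ω | ω ∈ Ioo 0 π ∧ |cos ω| < a}.indicator H) (Ioo 0 π) := by
    intro ω hω
    by_cases h1 : |cos ω| < a
    · rw [indicator_of_mem (show ω ∈ {ω | |cos ω| ≤ a} from h1.le),
        indicator_of_mem (show ω ∈ {ω | ω ∈ Ioo 0 π ∧ |cos ω| < a} from ⟨hω, h1⟩)]
    · rw [indicator_of_notMem (show ω ∉ {ω | ω ∈ Ioo 0 π ∧ |cos ω| < a} from fun h => h1 h.2)]
      by_cases h2 : |cos ω| ≤ a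
      · have : cos ω ^ 2 = a ^ 2 := by rw [← sq_abs, le_antisymm h2 (not_lt.1 h1)]
        rw [indicator_of_mem (show ω ∈ {ω | |cos ω| ≤ a} from h2)]
        simp [hH, this]
      · rw [indicator_of_notMem (show ω ∉ {ω | |cos ω| ≤ a} from h2)]
  have hint : Ioo 0 π ∩ {ω | ω ∈ Ioo 0 π ∧ |cos ω| < a} = quasiEnergy a '' Ioo 0 π := by
    rw [image_quasiEnergy ha0 ha1]; ext; simp +contextual
  have hd : ∀ k ∈ Ioo 0 π, HasDerivWithinAt (quasiEnergy a)
      (a * sin k * (√(1 - (a * cos k) ^ 2))⁻¹) (Ioo 0 π) k :=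
    fun k _ => (hasDerivAt_quasiEnergy ha0 ha1 k).hasDerivWithinAt
  have hcongr : EqOn (fun k => |a * sin k * (√(1 - (a * cos k) ^ 2))⁻¹| • H (quasiEnergy a k))
      (fun k => (((√(1 - (a * cos k) ^ 2))⁻¹ : ℝ) : ℂ) * ψ (quasiEnergy a k)) (Ioo 0 π) := by
    intro k hk
    have hs := Real.sin_pos_of_mem_Ioo hk
    have hp := (sqrt_one_sub_pos ha0 ha1 k)
    have hp' := hp.1.trans_le hp.2
    have e1 : √(a ^ 2 - (a * cos k) ^ 2) = a * sin k := by
      rw [show a ^ 2 - (a * cos k) ^ 2 = (a * sin k) ^ 2 by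
        rw [mul_pow, mul_pow, Real.sin_sq]; ring]
      exact Real.sqrt_sq (by positivity)
    have e2 : |a * sin k * (√(1 - (a * cos k) ^ 2))⁻¹| * (a * sin k)⁻¹ =
        (√(1 - (a * cos k) ^ 2))⁻¹ := by
      rw [abs_of_pos (by positivity)]
      field_simp
    simp only [hH, cos_quasiEnergy ha0 ha1, e1]
    rw [Complex.real_smul, ← mul_assoc, ← Complex.ofReal_mul, e2]
  constructor
  · rw [integrableOn_congr_fun hind measurableSet_Ioo, IntegrableOn,
      integrable_indicator_iff hE, IntegrableOn, Measure.restrict_restrict hE, inter_comm, hint,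
      ← IntegrableOn, integrableOn_image_iff_integrableOn_abs_deriv_smul measurableSet_Ioo hd
        (injOn_quasiEnergy ha0 ha1), integrableOn_congr_fun hcongr measurableSet_Ioo]
    have : IsFiniteMeasure (volume.restrict (Ioo 0 π)) := ⟨by simp⟩
    refine Integrable.of_bound (C := (√(1 - a ^ 2))⁻¹ * M) ?_
      (Filter.Eventually.of_forall fun k => ?_)
    · refine Measurable.aestronglyMeasurable ?_
      have h1 : Measurable fun k => ψ (quasiEnergy a k) :=
        hψ.comp (continuous_quasiEnergy a).measurable
      exact Measurable.mul (by fun_prop) h1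
    · obtain ⟨h1, h2⟩ := sqrt_one_sub_pos ha0 ha1 k
      rw [norm_mul, Complex.norm_real, Real.norm_of_nonneg (by positivity)]
      have := inv_anti₀ h1 h2
      exact mul_le_mul this (hM _) (norm_nonneg _) (by positivity)
  · rw [setIntegral_congr_fun measurableSet_Ioo hind, setIntegral_indicator hE, hint,
      integral_image_eq_integral_abs_deriv_smul measurableSet_Ioo hd
        (injOn_quasiEnergy ha0 ha1), setIntegral_congr_fun measurableSet_Ioo hcongr]

lemma integral_circleLebesgue {G : Circle → ℂ} (hG : Measurable G)
    (h1 : IntegrableOn (fun ω => G (Circle.exp ω)) (Ioo 0 π))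
    (h2 : IntegrableOn (fun ω => G (Circle.exp (-ω))) (Ioo 0 π)) :
    Integrable G circleLebesgue ∧
      ∫ ζ, G ζ ∂circleLebesgue =
        ((2 * π)⁻¹ : ℝ) * ((∫ ω in Ioo 0 π, G (Circle.exp ω)) +
          ∫ ω in Ioo 0 π, G (Circle.exp (-ω))) := by
  have hexp : Measurable (Circle.exp : ℝ → Circle) := Circle.exp.continuous.measurable
  have i1 : IntervalIntegrable (fun ω => G (Circle.exp ω)) volume 0 π := by
    rw [intervalIntegrable_iff_integrableOn_Ioo_of_le Real.pi_pos.le]; exact h1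
  have i2 : IntervalIntegrable (fun ω => G (Circle.exp ω)) volume (-π) 0 := by
    have : IntervalIntegrable (fun ω => G (Circle.exp (-ω))) volume 0 π := by
      rw [intervalIntegrable_iff_integrableOn_Ioo_of_le Real.pi_pos.le]; exact h2
    have h3 := this.comp_sub_left 0
    simpa using h3.symm
  have i3 := i2.trans i1
  have hle : -π ≤ π := by linarith [Real.pi_pos]
  constructor
  · refine Integrable.smul_measure ?_ ENNReal.ofReal_ne_top
    rw [integrable_map_measure hG.aestronglyMeasurable hexp.aemeasurable]
    exact (intervalIntegrable_iff_integrableOn_Ioc_of_le hle).1 i3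
  · rw [circleLebesgue, integral_smul_measure, integral_map hexp.aemeasurable
      hG.aestronglyMeasurable, ENNReal.toReal_ofReal (by positivity), Complex.real_smul,
      ← intervalIntegral.integral_of_le hle,
      ← intervalIntegral.integral_add_adjacent_intervals i2 i1]
    congr 1
    have e : ∫ ω in (-π)..0, G (Circle.exp ω) = ∫ ω in (0 : ℝ)..π, G (Circle.exp (-ω)) := by
      rw [intervalIntegral.integral_comp_neg (fun ω => G (Circle.exp ω)), neg_zero]
    rw [e, intervalIntegral.integral_of_le Real.pi_pos.le,
      intervalIntegral.integral_of_le Real.pi_pos.le, integral_Ioc_eq_integral_Ioo,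
      integral_Ioc_eq_integral_Ioo, add_comm]

/-- Integration against the weight `1 / √(a² - (Re ζ)²)` on the arcs `|Re ζ| ≤ a`: after the
substitution `Re ζ = a cos k` on the upper and on the lower arc, the singularities disappear. -/
lemma integral_arcs_weight {a : ℝ} (ha0 : 0 < a) (ha1 : a < 1) {φ : Circle → ℂ}
    (hφ : Measurable φ) {M : ℝ} (hM : ∀ ζ, ‖φ ζ‖ ≤ M) :
    Integrable ((arcs a).indicator
        fun ζ => (((√(a ^ 2 - (ζ : ℂ).re ^ 2))⁻¹ : ℝ) : ℂ) * φ ζ) circleLebesgue ∧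
      ∫ ζ, (arcs a).indicator
        (fun ζ => (((√(a ^ 2 - (ζ : ℂ).re ^ 2))⁻¹ : ℝ) : ℂ) * φ ζ) ζ ∂circleLebesgue =
      ((2 * π)⁻¹ : ℝ) * ∫ k in Ioo 0 π, (((√(1 - (a * cos k) ^ 2))⁻¹ : ℝ) : ℂ) *
        (φ (Circle.exp (quasiEnergy a k)) + φ (Circle.exp (-quasiEnergy a k))) := by
  have hexp : Measurable (Circle.exp : ℝ → Circle) := Circle.exp.continuous.measurable
  have hre : ∀ ω : ℝ, ((Circle.exp ω : Circle) : ℂ).re = cos ω := fun ω => by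
    rw [Circle.coe_exp, Complex.exp_ofReal_mul_I_re]
  set G : Circle → ℂ := (arcs a).indicator
    fun ζ => (((√(a ^ 2 - (ζ : ℂ).re ^ 2))⁻¹ : ℝ) : ℂ) * φ ζ with hG
  have hGm : Measurable G := by
    refine Measurable.indicator ?_ (isClosed_arcs a).measurableSet
    have h1 : Continuous fun ζ : Circle => (ζ : ℂ).re :=
      Complex.continuous_re.comp continuous_subtype_val
    have h2 := h1.measurable
    fun_prop
  have g1 : (fun ω => G (Circle.exp ω)) = {ω | |cos ω| ≤ a}.indicator
      fun ω => (((√(a ^ 2 - cos ω ^ 2))⁻¹ : ℝ) : ℂ) * φ (Circle.exp ω) := by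
    ext ω
    simp only [hG, indicator, arcs, mem_ofPred_eq, hre]
  have g2 : (fun ω => G (Circle.exp (-ω))) = {ω | |cos ω| ≤ a}.indicator
      fun ω => (((√(a ^ 2 - cos ω ^ 2))⁻¹ : ℝ) : ℂ) * φ (Circle.exp (-ω)) := by
    ext ω
    simp only [hG, indicator, arcs, mem_ofPred_eq, hre, cos_neg]
  obtain ⟨p1, q1⟩ := integral_arcsine_weight ha0 ha1 (hφ.comp hexp) fun ω => hM (Circle.exp ω)
  obtain ⟨p2, q2⟩ := integral_arcsine_weight ha0 ha1 (hφ.comp (hexp.comp measurable_neg))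
    fun ω => hM (Circle.exp (-ω))
  obtain ⟨r1, r2⟩ := integral_circleLebesgue hGm (by rw [g1]; exact p1) (by rw [g2]; exact p2)
  refine ⟨r1, ?_⟩
  have hfin : IsFiniteMeasure (volume.restrict (Ioo 0 π)) := ⟨by simp⟩
  have hi : ∀ σ : ℝ → ℝ, Measurable σ → Integrable (fun k =>
      (((√(1 - (a * cos k) ^ 2))⁻¹ : ℝ) : ℂ) * φ (Circle.exp (σ k)))
      (volume.restrict (Ioo 0 π)) := by
    intro σ hσ
    refine Integrable.of_bound (C := (√(1 - a ^ 2))⁻¹ * M) ?_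
      (Filter.Eventually.of_forall fun k => ?_)
    · refine Measurable.aestronglyMeasurable ?_
      have h1 : Measurable fun k => φ (Circle.exp (σ k)) := hφ.comp (hexp.comp hσ)
      exact Measurable.mul (by fun_prop) h1
    · obtain ⟨h1, h2⟩ := sqrt_one_sub_pos ha0 ha1 k
      rw [norm_mul, Complex.norm_real, Real.norm_of_nonneg (by positivity)]
      exact mul_le_mul (inv_anti₀ h1 h2) (hM _) (norm_nonneg _) (by positivity)
  have hq := (continuous_quasiEnergy a).measurable
  have q1' : ∫ ω in Ioo 0 π, G (Circle.exp ω) = _ := (congrArg _ g1).trans q1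
  have q2' : ∫ ω in Ioo 0 π, G (Circle.exp (-ω)) = _ := (congrArg _ g2).trans q2
  simp only [Function.comp_def] at q1' q2'
  rw [r2, q1', q2', ← integral_add (hi _ hq) (hi (fun k => -quasiEnergy a k) hq.neg)]
  simp only [mul_add]

end ArcIntegral

/-! ### Algebra of the transfer matrices -/

section TransferMatrix

/-- The adjoint `T(z)ᴴ` of the homogeneous transfer matrix at a point `z` of the unit circle,
where `z⁻¹ = conj z`. -/
def dualTransfer (α β z : ℂ) : Matrix (Fin 2) (Fin 2) ℂ :=
  !![(conj z + z * (β * conj β)) / conj α, -(z * β);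
    -(z * conj β * α / conj α), z * α]

/-- The numerator of the spectral density: on the arcs, the density is
`sgn (Im z) (|α|² - (Re z)²)^(-1/2)` times this matrix, which is a trigonometric polynomial. -/
def densityNumerator (α β z : ℂ) : Matrix (Fin 2) (Fin 2) ℂ :=
  !![(z.im : ℂ), -(Complex.I * (β / α) * (z.re : ℂ));
    Complex.I * (conj β / conj α) * (z.re : ℂ), (z.im : ℂ)]

lemma exists_re_im {z : ℂ} (hz : ‖z‖ = 1) : ∃ c s : ℝ, z.re = c ∧ z.im = s ∧
    z = c + s * Complex.I ∧ conj z = c - s * Complex.I ∧ (c : ℂ) ^ 2 + (s : ℂ) ^ 2 = 1 := by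
  refine ⟨z.re, z.im, rfl, rfl, (Complex.re_add_im z).symm, ?_, ?_⟩
  · apply Complex.ext <;> simp
  · have h := Complex.sq_norm z
    rw [hz, Complex.normSq_apply] at h
    have : z.re ^ 2 + z.im ^ 2 = 1 := by nlinarith
    exact_mod_cast this

variable {α β : ℂ}

lemma conjTranspose_densityNumerator (z : ℂ) :
    (densityNumerator α β z)ᴴ = densityNumerator α β z := by
  ext i j
  fin_cases i <;> fin_cases j <;> simp [densityNumerator]

lemma det_dualTransfer (hα : α ≠ 0) {z : ℂ} (hz : ‖z‖ = 1) :
    (dualTransfer α β z).det = α / conj α := by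
  have hα' : conj α ≠ 0 := by simpa using hα
  obtain ⟨c, s, -, -, h1, h2, h3⟩ := exists_re_im hz
  have hI := Complex.I_sq
  rw [dualTransfer, Matrix.det_fin_two_of, h2, h1]
  generalize conj α = α' at *
  generalize conj β = β' at *
  field_simp
  grind

lemma dualTransfer_sq (hα : α ≠ 0) (hab : α * conj α + β * conj β = 1) {z : ℂ} (hz : ‖z‖ = 1) :
    dualTransfer α β z * dualTransfer α β z =
      (2 * (z.re : ℂ) / conj α) • dualTransfer α β z - (α / conj α) • 1 := by
  have hα' : conj α ≠ 0 := by simpa using hα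
  obtain ⟨c, s, hc, -, h1, h2, h3⟩ := exists_re_im hz
  have hI := Complex.I_sq
  rw [dualTransfer, h2, hc, h1]
  generalize conj α = α' at *
  generalize conj β = β' at *
  ext i j
  fin_cases i <;> fin_cases j <;> simp [Matrix.mul_apply] <;> field_simp <;> grind

lemma conjTranspose_dualTransfer_mul (hα : α ≠ 0) (hab : α * conj α + β * conj β = 1) {z : ℂ}
    (hz : ‖z‖ = 1) :
    (dualTransfer α β z)ᴴ * densityNumerator α β z * dualTransfer α β z =
      densityNumerator α β z := by
  have hα' : conj α ≠ 0 := by simpa using hα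
  obtain ⟨c, s, hc, hs, h1, h2, h3⟩ := exists_re_im hz
  have hI := Complex.I_sq
  have e : (dualTransfer α β z)ᴴ = !![(z + conj z * (β * conj β)) / α,
      -(conj z * β * conj α / α); -(conj z * conj β), conj z * conj α] := by
    ext i j
    fin_cases i <;> fin_cases j <;> simp [dualTransfer, mul_comm]
  rw [e, dualTransfer, densityNumerator, h2, hc, hs, h1]
  generalize conj α = α' at *
  generalize conj β = β' at *
  ext i j
  fin_cases i <;> fin_cases j <;> simp [Matrix.mul_apply] <;> field_simp <;> grind

lemma densityNumerator_sub_conj (z : ℂ) :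
    densityNumerator α β z - densityNumerator α β (conj z) = (2 * (z.im : ℂ)) • 1 := by
  ext i j
  fin_cases i <;> fin_cases j <;> simp [densityNumerator] <;> ring

lemma densityNumerator_mul_dualTransfer_sub_conj (hα : α ≠ 0)
    (hab : α * conj α + β * conj β = 1) {z : ℂ} (hz : ‖z‖ = 1) :
    densityNumerator α β z * dualTransfer α β z -
      densityNumerator α β (conj z) * dualTransfer α β (conj z) =
      (2 * (z.im : ℂ) * (z.re : ℂ) / conj α) • 1 := by
  have hα' : conj α ≠ 0 := by simpa using hα
  obtain ⟨c, s, hc, hs, h1, h2, h3⟩ := exists_re_im hz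
  have hI := Complex.I_sq
  rw [dualTransfer, dualTransfer, densityNumerator, densityNumerator, Complex.conj_re,
    Complex.conj_im, Complex.conj_conj, h2, hc, hs, h1]
  generalize conj α = α' at *
  generalize conj β = β' at *
  ext i j
  fin_cases i <;> fin_cases j <;> simp <;> field_simp <;> grind

/-- Multiplied by `A ^ (x - 1)`, where `A = dualTransfer α β z`, this reads
`A ^ (x - 1) π_L C + A ^ (x + 1) π_R C = z A ^ x`: the matrices `A ^ x` intertwine the walk with the
multiplication by `z`. -/
lemma dualTransfer_eigen (hα : α ≠ 0) (hab : α * conj α + β * conj β = 1) {z : ℂ}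
    (hz : ‖z‖ = 1) :
    projL * !![α, β; -conj β, conj α] +
      dualTransfer α β z * dualTransfer α β z * (projR * !![α, β; -conj β, conj α]) =
      z • dualTransfer α β z := by
  have hα' : conj α ≠ 0 := by simpa using hα
  obtain ⟨c, s, hc, hs, h1, h2, h3⟩ := exists_re_im hz
  have hI := Complex.I_sq
  rw [dualTransfer, h2, h1, projL, projR]
  generalize conj α = α' at *
  generalize conj β = β' at *
  ext i j
  fin_cases i <;> fin_cases j <;> simp <;> field_simp <;> grind

end TransferMatrix

/-! ### The spectral density and its orthogonality relations -/

section Density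

open Real Set

/-- Two sequences on `ℤ` which satisfy the same second order recursion agree if they agree at
`0` and `1`. -/
lemma eq_of_recursion {V : Type*} [AddCommGroup V] [Module ℂ V] {p q : ℂ} (hq : q ≠ 0)
    {X Y : ℤ → V} (hX : ∀ n, X (n + 2) = p • X (n + 1) - q • X n)
    (hY : ∀ n, Y (n + 2) = p • Y (n + 1) - q • Y n) (h0 : X 0 = Y 0) (h1 : X 1 = Y 1) (n : ℤ) :
    X n = Y n := by
  suffices h : X n = Y n ∧ X (n + 1) = Y (n + 1) from h.1
  induction n using Int.induction_on with
  | zero => exact ⟨h0, h1⟩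
  | succ k ih =>
    refine ⟨ih.2, ?_⟩
    rw [add_assoc, one_add_one_eq_two, hX, hY, ih.1, ih.2]
  | pred k ih =>
    have e : -(k : ℤ) - 1 + 1 = -k := by ring
    rw [e]
    refine ⟨?_, ih.1⟩
    have h3 := hX (-(k : ℤ) - 1)
    have h4 := hY (-(k : ℤ) - 1)
    rw [show -(k : ℤ) - 1 + 2 = -k + 1 by ring, e] at h3 h4
    rw [ih.1, ih.2, h4] at h3
    exact (smul_right_injective V hq (sub_right_injective h3)).symm

variable {α β : ℂ}

lemma isUnit_det_dualTransfer (hα : α ≠ 0) {z : ℂ} (hz : ‖z‖ = 1) :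
    IsUnit (dualTransfer α β z).det := by
  rw [det_dualTransfer hα hz]
  exact (div_ne_zero hα (by simpa using hα)).isUnit

lemma dualTransfer_zpow_add_two (hα : α ≠ 0) (hab : α * conj α + β * conj β = 1) {z : ℂ}
    (hz : ‖z‖ = 1) (n : ℤ) :
    dualTransfer α β z ^ (n + 2) = (2 * (z.re : ℂ) / conj α) • dualTransfer α β z ^ (n + 1) -
      (α / conj α) • dualTransfer α β z ^ n := by
  have hu := isUnit_det_dualTransfer (β := β) hα hz
  rw [show n + 2 = n + 1 + 1 by ring, Matrix.zpow_add_one hu, Matrix.zpow_add_one hu, mul_assoc,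
    dualTransfer_sq hα hab hz, mul_sub, mul_smul_comm, mul_smul_comm, mul_one]

/-- With `Re z = |α| cos k`, the dual transfer matrix has the eigenvalues `(|α| / conj α) e^{±ik}`;
antisymmetrized over `z ↔ conj z`, the density times its powers is a scalar matrix. -/
lemma densityNumerator_mul_zpow_sub_conj (hα : α ≠ 0) (hab : α * conj α + β * conj β = 1) {z : ℂ}
    (hz : ‖z‖ = 1) {k : ℝ} (hk : z.re = ‖α‖ * cos k) (n : ℤ) :
    densityNumerator α β z * dualTransfer α β z ^ n -
      densityNumerator α β (conj z) * dualTransfer α β (conj z) ^ n =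
      (2 * (z.im : ℂ) * (((‖α‖ : ℂ) / conj α) ^ n * (cos (n * k) : ℂ))) •
        (1 : Matrix (Fin 2) (Fin 2) ℂ) := by
  have hα' : conj α ≠ 0 := by simpa using hα
  have hn : (‖α‖ : ℂ) ≠ 0 := by simpa using hα
  have hz' : ‖conj z‖ = 1 := by rwa [Complex.norm_conj]
  have hsq : α * conj α = (‖α‖ : ℂ) ^ 2 := Complex.mul_conj' α
  refine eq_of_recursion (p := 2 * (z.re : ℂ) / conj α) (q := α / conj α) (div_ne_zero hα hα')
    (X := fun n : ℤ => densityNumerator α β z * dualTransfer α β z ^ n -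
      densityNumerator α β (conj z) * dualTransfer α β (conj z) ^ n)
    (Y := fun n : ℤ => (2 * (z.im : ℂ) * (((‖α‖ : ℂ) / conj α) ^ n * (cos (n * k) : ℂ))) •
        (1 : Matrix (Fin 2) (Fin 2) ℂ)) (fun n => ?_) (fun n => ?_) ?_ ?_ n
  · simp only [dualTransfer_zpow_add_two hα hab hz, dualTransfer_zpow_add_two hα hab hz',
      Complex.conj_re, mul_sub, mul_smul_comm, smul_sub]
    abel
  · simp only [smul_smul, ← sub_smul]
    congr 1
    have hcos : cos ((n + 2 : ℤ) * k) = 2 * cos k * cos ((n + 1 : ℤ) * k) - cos (n * k) := by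
      have h1 := Real.cos_add ((n + 1 : ℤ) * k) k
      have h2 := Real.cos_sub ((n + 1 : ℤ) * k) k
      have e1 : ((n + 1 : ℤ) : ℝ) * k + k = (n + 2 : ℤ) * k := by push_cast; ring
      have e2 : ((n + 1 : ℤ) : ℝ) * k - k = n * k := by push_cast; ring
      rw [e1] at h1
      rw [e2] at h2
      linarith
    have ht : (‖α‖ : ℂ) / conj α ≠ 0 := div_ne_zero hn hα'
    have hq : α / conj α = ((‖α‖ : ℂ) / conj α) ^ 2 := by
      rw [div_pow, ← hsq]; field_simp
    have hp : 2 * (z.re : ℂ) / conj α = 2 * (cos k : ℂ) * ((‖α‖ : ℂ) / conj α) := by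
      rw [hk]; push_cast; ring
    rw [hcos, hq, hp, zpow_add₀ ht, zpow_add₀ ht, zpow_one]
    norm_cast
    push_cast
    ring
  · simp only [zpow_zero, mul_one, Int.cast_zero, zero_mul, cos_zero, Complex.ofReal_one]
    exact densityNumerator_sub_conj z
  · simp only [zpow_one, Int.cast_one, one_mul]
    rw [densityNumerator_mul_dualTransfer_sub_conj hα hab hz, hk]
    congr 1
    push_cast
    ring

lemma continuous_dualTransfer_zpow (hα : α ≠ 0) (n : ℤ) :
    Continuous fun ζ : Circle => dualTransfer α β (ζ : ℂ) ^ n := by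
  have hcoe : Continuous fun ζ : Circle => (ζ : ℂ) := continuous_subtype_val
  have hA : Continuous fun ζ : Circle => dualTransfer α β (ζ : ℂ) := by
    refine continuous_matrix fun i j => ?_
    fin_cases i <;> fin_cases j <;> simp [dualTransfer] <;> fun_prop
  have hAi : Continuous fun ζ : Circle => (dualTransfer α β (ζ : ℂ))⁻¹ := by
    simp only [Matrix.inv_def, det_dualTransfer hα (Circle.norm_coe _)]
    exact hA.matrix_adjugate.const_smul (Ring.inverse (α / conj α))
  rcases n with n | n
  · simp only [Int.ofNat_eq_natCast, zpow_natCast]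
    exact hA.pow n
  · simp only [zpow_negSucc, ← Matrix.inv_pow']
    exact hAi.pow _

/-- The spectral density, with the characteristic function of the arcs included. -/
def density (α β : ℂ) (ζ : Circle) : Matrix (Fin 2) (Fin 2) ℂ :=
  (arcs ‖α‖).indicator (homogeneousDensity α β) ζ

lemma homogeneousDensity_eq (ζ : Circle) :
    homogeneousDensity α β ζ = (((√(‖α‖ ^ 2 - (ζ : ℂ).re ^ 2))⁻¹ : ℝ) : ℂ) •
      ((Real.sign (ζ : ℂ).im : ℂ) • densityNumerator α β ζ) := by
  have h : ((|(ζ : ℂ).im| : ℝ) : ℂ) = (Real.sign (ζ : ℂ).im : ℂ) * ((ζ : ℂ).im : ℂ) := by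
    rw [← Complex.ofReal_mul]
    congr 1
    rcases lt_trichotomy (ζ : ℂ).im 0 with h | h | h
    · rw [Real.sign_of_neg h, abs_of_neg h, neg_one_mul]
    · simp [h]
    · rw [Real.sign_of_pos h, abs_of_pos h, one_mul]
  rw [homogeneousDensity, h]
  congr 1
  ext i j
  fin_cases i <;> fin_cases j <;> simp [densityNumerator] <;> ring

lemma density_apply (ζ : Circle) (i j : Fin 2) :
    density α β ζ i j = (arcs ‖α‖).indicator (fun ζ => homogeneousDensity α β ζ i j) ζ := by
  by_cases h : ζ ∈ arcs ‖α‖ <;> simp [density, h]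

lemma measurable_sign_im : Measurable fun ζ : Circle => ((Real.sign (ζ : ℂ).im : ℝ) : ℂ) := by
  have h : Measurable fun ζ : Circle => (ζ : ℂ).im :=
    (show Continuous fun ζ : Circle => (ζ : ℂ).im from
      Complex.continuous_im.comp continuous_subtype_val).measurable
  have hs : Measurable Real.sign := by
    unfold Real.sign
    exact Measurable.ite measurableSet_Iio measurable_const
      (Measurable.ite measurableSet_Ioi measurable_const measurable_const)
  exact Complex.measurable_ofReal.comp (hs.comp h)

lemma continuous_densityNumerator :
    Continuous fun ζ : Circle => densityNumerator α β (ζ : ℂ) := by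
  have hcoe : Continuous fun ζ : Circle => (ζ : ℂ) := continuous_subtype_val
  have h1 : Continuous fun ζ : Circle => ((ζ : ℂ).re : ℂ) := by fun_prop
  have h2 : Continuous fun ζ : Circle => ((ζ : ℂ).im : ℂ) := by fun_prop
  refine continuous_matrix fun i j => ?_
  fin_cases i <;> fin_cases j <;> simp [densityNumerator] <;> fun_prop

lemma norm_sign_le (x : ℝ) : ‖((Real.sign x : ℝ) : ℂ)‖ ≤ 1 := by
  rcases Real.sign_apply_eq x with h | h | h <;> simp [h]

lemma exists_norm_bound {f : Circle → ℂ} (hf : Continuous f) : ∃ M : ℝ, ∀ ζ, ‖f ζ‖ ≤ M := by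
  obtain ⟨M, hM⟩ := isCompact_univ.exists_bound_of_continuousOn hf.continuousOn
  exact ⟨M, fun ζ => hM ζ trivial⟩

/-- The density times a function which is bounded on the arcs is integrable: the density has only
inverse square root singularities, at the ends of the arcs. -/
lemma integrable_mul_density (hα : α ≠ 0) (hα1 : ‖α‖ < 1) {h : Circle → ℂ} (hh : Measurable h)
    {M : ℝ} (hM : ∀ ζ ∈ arcs ‖α‖, ‖h ζ‖ ≤ M) (i j : Fin 2) :
    Integrable (fun ζ => h ζ * density α β ζ i j) circleLebesgue := by
  have hP : Continuous fun ζ : Circle => densityNumerator α β (ζ : ℂ) i j :=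
    continuous_densityNumerator.matrix_elem i j
  obtain ⟨B, hB⟩ := exists_norm_bound hP
  have hBnn : 0 ≤ B := (norm_nonneg _).trans (hB 1)
  have hM0 : ∀ ζ, ‖(arcs ‖α‖).indicator h ζ‖ ≤ max M 0 := fun ζ => by
    by_cases hζ : ζ ∈ arcs ‖α‖
    · rw [indicator_of_mem hζ]; exact (hM ζ hζ).trans (le_max_left _ _)
    · rw [indicator_of_notMem hζ]; simp
  have key := (integral_arcs_weight (norm_pos_iff.2 hα) hα1
    (φ := fun ζ => (arcs ‖α‖).indicator h ζ *
      ((Real.sign (ζ : ℂ).im : ℂ) * densityNumerator α β (ζ : ℂ) i j))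
    ((hh.indicator (isClosed_arcs _).measurableSet).mul (measurable_sign_im.mul hP.measurable))
    (M := max M 0 * (1 * B)) (fun ζ => by
      rw [norm_mul, norm_mul]
      exact mul_le_mul (hM0 ζ) (mul_le_mul (norm_sign_le _) (hB ζ) (norm_nonneg _) zero_le_one)
        (by positivity) (le_max_right _ _))).1
  refine key.congr (Filter.Eventually.of_forall fun ζ => ?_)
  beta_reduce
  rw [density_apply]
  by_cases hζ : ζ ∈ arcs ‖α‖
  · simp only [indicator_of_mem hζ, homogeneousDensity_eq, Matrix.smul_apply, smul_eq_mul]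
    ring
  · simp only [indicator_of_notMem hζ, mul_zero]

lemma integral_cos_int_mul (n : ℤ) :
    ∫ k in Ioo 0 π, cos (n * k) = if n = 0 then π else 0 := by
  rw [← integral_Ioc_eq_integral_Ioo, ← intervalIntegral.integral_of_le Real.pi_pos.le]
  split_ifs with h
  · simp [h]
  · have hn : (n : ℝ) ≠ 0 := by exact_mod_cast h
    rw [intervalIntegral.integral_comp_mul_left (fun x => cos x) hn, integral_cos]
    simp [Real.sin_int_mul_pi]

/-- The orthogonality relations of the generalized eigenfunctions. -/
lemma integral_density_mul_zpow (hα : α ≠ 0) (hα1 : ‖α‖ < 1)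
    (hab : α * conj α + β * conj β = 1) (n : ℤ) (i j : Fin 2) :
    ∫ ζ : Circle, (density α β ζ * dualTransfer α β (ζ : ℂ) ^ n) i j ∂circleLebesgue =
      if n = 0 then (1 : Matrix (Fin 2) (Fin 2) ℂ) i j else 0 := by
  have ha := norm_pos_iff.2 hα
  have hPA : Continuous fun ζ : Circle =>
      (densityNumerator α β (ζ : ℂ) * dualTransfer α β (ζ : ℂ) ^ n) i j :=
    (continuous_densityNumerator.matrix_mul (continuous_dualTransfer_zpow hα n)).matrix_elem i j
  obtain ⟨B, hB⟩ := exists_norm_bound hPA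
  have key := (integral_arcs_weight ha hα1
    (φ := fun ζ => (Real.sign (ζ : ℂ).im : ℂ) *
      (densityNumerator α β (ζ : ℂ) * dualTransfer α β (ζ : ℂ) ^ n) i j)
    (measurable_sign_im.mul hPA.measurable) (M := 1 * B) (fun ζ => by
      rw [norm_mul]
      exact mul_le_mul (norm_sign_le _) (hB ζ) (norm_nonneg _) zero_le_one)).2
  have e1 : (fun ζ : Circle => (density α β ζ * dualTransfer α β (ζ : ℂ) ^ n) i j) =
      (arcs ‖α‖).indicator fun ζ => (((√(‖α‖ ^ 2 - (ζ : ℂ).re ^ 2))⁻¹ : ℝ) : ℂ) *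
        ((Real.sign (ζ : ℂ).im : ℂ) *
          (densityNumerator α β (ζ : ℂ) * dualTransfer α β (ζ : ℂ) ^ n) i j) := by
    ext ζ
    by_cases hζ : ζ ∈ arcs ‖α‖
    · rw [indicator_of_mem hζ, density, indicator_of_mem hζ, homogeneousDensity_eq, smul_mul_assoc,
        smul_mul_assoc, Matrix.smul_apply, Matrix.smul_apply, smul_eq_mul, smul_eq_mul]
    · rw [indicator_of_notMem hζ, density, indicator_of_notMem hζ, zero_mul, Matrix.zero_apply]
  rw [e1, key]
  have e2 : ∀ k : ℝ, (((√(1 - (‖α‖ * cos k) ^ 2))⁻¹ : ℝ) : ℂ) *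
      ((Real.sign ((Circle.exp (quasiEnergy ‖α‖ k) : Circle) : ℂ).im : ℂ) *
        (densityNumerator α β ((Circle.exp (quasiEnergy ‖α‖ k) : Circle) : ℂ) *
          dualTransfer α β ((Circle.exp (quasiEnergy ‖α‖ k) : Circle) : ℂ) ^ n) i j +
      (Real.sign ((Circle.exp (-quasiEnergy ‖α‖ k) : Circle) : ℂ).im : ℂ) *
        (densityNumerator α β ((Circle.exp (-quasiEnergy ‖α‖ k) : Circle) : ℂ) *
          dualTransfer α β ((Circle.exp (-quasiEnergy ‖α‖ k) : Circle) : ℂ) ^ n) i j) =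
      2 * (((‖α‖ : ℂ) / conj α) ^ n * (1 : Matrix (Fin 2) (Fin 2) ℂ) i j) *
        (cos (n * k) : ℂ) := by
    intro k
    obtain ⟨z, hz⟩ : ∃ z : ℂ, z = ((Circle.exp (quasiEnergy ‖α‖ k) : Circle) : ℂ) := ⟨_, rfl⟩
    have hre : z.re = ‖α‖ * cos k := by
      rw [hz, Circle.coe_exp, Complex.exp_ofReal_mul_I_re, cos_quasiEnergy ha hα1]
    have him : z.im = √(1 - (‖α‖ * cos k) ^ 2) := by
      rw [hz, Circle.coe_exp, Complex.exp_ofReal_mul_I_im, sin_quasiEnergy]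
    have hp := sqrt_one_sub_pos ha hα1 k
    have hpos : 0 < z.im := by rw [him]; exact hp.1.trans_le hp.2
    have hconj : ((Circle.exp (-quasiEnergy ‖α‖ k) : Circle) : ℂ) = conj z := by
      rw [Circle.exp_neg, Circle.coe_inv_eq_conj, hz]
    have h := congrFun (congrFun (densityNumerator_mul_zpow_sub_conj hα hab
      (show ‖z‖ = 1 by rw [hz, Circle.norm_coe]) hre n) i) j
    rw [Matrix.sub_apply, Matrix.smul_apply, smul_eq_mul] at h
    rw [hconj, ← hz, Complex.conj_im, Real.sign_of_pos hpos, Real.sign_of_neg (neg_lt_zero.2 hpos),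
      ← him]
    rw [Complex.ofReal_one, Complex.ofReal_neg, Complex.ofReal_one, one_mul, neg_one_mul,
      ← sub_eq_add_neg, h]
    have : (z.im : ℂ) ≠ 0 := by exact_mod_cast hpos.ne'
    push_cast
    field_simp
  simp only [e2]
  rw [integral_const_mul, integral_complex_ofReal, integral_cos_int_mul]
  split_ifs with h
  · subst h
    have : (π : ℂ) ≠ 0 := by exact_mod_cast Real.pi_ne_zero
    push_cast
    rw [zpow_zero]
    field_simp
  · simp

lemma semiconj_densityNumerator (hα : α ≠ 0) (hab : α * conj α + β * conj β = 1) {z : ℂ}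
    (hz : ‖z‖ = 1) (x y : ℤ) :
    (dualTransfer α β z ^ y)ᴴ * densityNumerator α β z * dualTransfer α β z ^ x =
      densityNumerator α β z * dualTransfer α β z ^ (x - y) := by
  have hu := isUnit_det_dualTransfer (β := β) hα hz
  have h1 := conjTranspose_dualTransfer_mul hα hab hz
  have h2 : SemiconjBy (densityNumerator α β z) (dualTransfer α β z)⁻¹ (dualTransfer α β z)ᴴ := by
    rw [SemiconjBy]
    nth_rewrite 1 [← h1]
    rw [mul_assoc, Matrix.mul_nonsing_inv _ hu, mul_one]
  have hu' : IsUnit ((dualTransfer α β z)⁻¹).det := Matrix.isUnit_nonsing_inv_det _ hu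
  have hu'' : IsUnit ((dualTransfer α β z)ᴴ).det := by
    rw [Matrix.det_conjTranspose]; exact hu.star
  have h3 := Matrix.SemiconjBy.zpow_right hu' hu'' h2 y
  rw [SemiconjBy] at h3
  rw [Matrix.conjTranspose_zpow, ← h3, mul_assoc, Matrix.inv_zpow', ← Matrix.zpow_add hu,
    neg_add_eq_sub]
  exact hu

/-- Translation invariance of the walk, seen on the level of the density. -/
lemma semiconj_density (hα : α ≠ 0) (hab : α * conj α + β * conj β = 1) (ζ : Circle) (x y : ℤ) :
    (dualTransfer α β (ζ : ℂ) ^ y)ᴴ * density α β ζ * dualTransfer α β (ζ : ℂ) ^ x =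
      density α β ζ * dualTransfer α β (ζ : ℂ) ^ (x - y) := by
  by_cases hζ : ζ ∈ arcs ‖α‖
  · rw [density, indicator_of_mem hζ, homogeneousDensity_eq]
    simp only [mul_smul_comm, smul_mul_assoc,
      semiconj_densityNumerator hα hab (Circle.norm_coe ζ)]
  · rw [density, indicator_of_notMem hζ, mul_zero, zero_mul, zero_mul]

lemma conjTranspose_density (ζ : Circle) : (density α β ζ)ᴴ = density α β ζ := by
  by_cases hζ : ζ ∈ arcs ‖α‖
  · rw [density, indicator_of_mem hζ, homogeneousDensity_eq]
    simp [Matrix.conjTranspose_smul, conjTranspose_densityNumerator]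
  · rw [density, indicator_of_notMem hζ, Matrix.conjTranspose_zero]

end Density

/-! ### The Plancherel formula -/

section SpectralForm

open Real Set

variable {α β : ℂ}

/-- `act M` as a linear map. -/
def actₗ (M : Matrix (Fin 2) (Fin 2) ℂ) : C2 →ₗ[ℂ] C2 where
  toFun := act M
  map_add' := act_add M
  map_smul' := act_smul M

lemma actₗ_apply (M : Matrix (Fin 2) (Fin 2) ℂ) (u : C2) : actₗ M u = act M u := rfl

lemma act_mul (M N : Matrix (Fin 2) (Fin 2) ℂ) (u : C2) : act (M * N) u = act M (act N u) := by
  rw [act, act, act, Matrix.mulVec_mulVec]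

lemma act_zero_matrix (u : C2) : act 0 u = 0 := by simp [act]

lemma inner_act (M : Matrix (Fin 2) (Fin 2) ℂ) (u v : C2) :
    inner ℂ v (act M u) = ∑ i, ∑ j, u j * conj (v i) * M i j := by
  simp [PiLp.inner_apply, act, Fin.sum_univ_two]
  ring

lemma inner_act_act (M N : Matrix (Fin 2) (Fin 2) ℂ) (u v : C2) :
    inner ℂ (act N v) (act M u) = inner ℂ v (act (Nᴴ * M) u) := by
  simp [PiLp.inner_apply, act, Fin.sum_univ_two, Matrix.mul_apply]
  ring

lemma posSemidef_iff_inner (M : Matrix (Fin 2) (Fin 2) ℂ) (hM : Mᴴ = M) :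
    M.PosSemidef ↔ ∀ u : C2, 0 ≤ inner ℂ u (act M u) := by
  rw [Matrix.posSemidef_iff_dotProduct_mulVec]
  constructor
  · rintro ⟨-, h⟩ u
    refine (h (WithLp.ofLp u)).trans_eq ?_
    simp [PiLp.inner_apply, act, dotProduct, Fin.sum_univ_two]
    ring
  · refine fun h => ⟨hM, fun x => (h (WithLp.toLp 2 x)).trans_eq ?_⟩
    simp [PiLp.inner_apply, act, dotProduct, Fin.sum_univ_two]
    ring

/-- The density is positive on the arcs: there `|Im ζ| ≥ |β / α| |Re ζ|`. -/
lemma posSemidef_density (hα : α ≠ 0) (hab : α * conj α + β * conj β = 1) (ζ : Circle) :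
    (density α β ζ).PosSemidef := by
  by_cases hζ : ζ ∈ arcs ‖α‖
  swap
  · rw [density, indicator_of_notMem hζ]; exact Matrix.PosSemidef.zero
  have hherm := conjTranspose_density (α := α) (β := β) ζ
  rw [density, indicator_of_mem hζ, homogeneousDensity] at hherm ⊢
  set w : ℝ := (√(‖α‖ ^ 2 - (ζ : ℂ).re ^ 2))⁻¹ with hw
  set c : ℝ := (ζ : ℂ).re with hc
  set s : ℝ := (ζ : ℂ).im with hs
  have hw0 : 0 ≤ w := by positivity
  set b : ℂ := Complex.I * (Real.sign s : ℂ) * (β / α) * (c : ℂ) with hb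
  have hb' : Complex.I * (Real.sign s : ℂ) * (conj β / conj α) * (c : ℂ) = -conj b := by
    rw [hb]; simp [mul_comm, mul_assoc]
  have hab' : ‖α‖ ^ 2 + ‖β‖ ^ 2 = 1 := by
    rw [Complex.mul_conj', Complex.mul_conj'] at hab
    exact_mod_cast hab
  have hcs : c ^ 2 + s ^ 2 = 1 := by
    have h := Complex.sq_norm (ζ : ℂ)
    rw [Circle.norm_coe, Complex.normSq_apply] at h
    rw [hc, hs]; nlinarith
  have hca : c ^ 2 ≤ ‖α‖ ^ 2 := by
    rw [← sq_abs c]; exact pow_le_pow_left₀ (abs_nonneg _) hζ 2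
  have hα0 := norm_pos_iff.2 hα
  have hbs : ‖b‖ ≤ |s| := by
    have h1 : ‖b‖ ≤ ‖β‖ / ‖α‖ * |c| := by
      rw [hb, norm_mul, norm_mul, norm_mul, Complex.norm_I, one_mul, norm_div,
        Complex.norm_real c, Real.norm_eq_abs]
      refine mul_le_mul_of_nonneg_right ?_ (abs_nonneg _)
      exact mul_le_of_le_one_left (by positivity) (norm_sign_le s)
    refine h1.trans (abs_le_of_sq_le_sq' ?_ (abs_nonneg s)).2
    rw [mul_pow, div_pow, sq_abs, sq_abs, div_mul_eq_mul_div, div_le_iff₀ (by positivity)]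
    nlinarith
  rw [hb'] at hherm ⊢
  refine (posSemidef_iff_inner _ hherm).2 fun u => ?_
  have hre : (u 0 * conj (u 1) * conj b).re ≤ ‖u 0‖ * ‖u 1‖ * |s| := by
    refine (Complex.re_le_norm _).trans ?_
    rw [norm_mul, norm_mul, Complex.norm_conj, Complex.norm_conj]
    exact mul_le_mul_of_nonneg_left hbs (by positivity)
  have e : inner ℂ u (act ((w : ℂ) • !![((|s| : ℝ) : ℂ), -b; -conj b, ((|s| : ℝ) : ℂ)]) u) =
      ((w * (|s| * (‖u 0‖ ^ 2 + ‖u 1‖ ^ 2) - 2 * (u 0 * conj (u 1) * conj b).re) : ℝ) : ℂ) := by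
    have h2 : ((2 * (u 0 * conj (u 1) * conj b).re : ℝ) : ℂ) =
        u 0 * conj (u 1) * conj b + conj (u 0 * conj (u 1) * conj b) := (Complex.add_conj _).symm
    rw [inner_act, Complex.ofReal_mul, Complex.ofReal_sub, h2]
    push_cast
    rw [← Complex.mul_conj' (u 0), ← Complex.mul_conj' (u 1)]
    simp [Fin.sum_univ_two]
    ring
  rw [e, Complex.zero_le_real]
  refine mul_nonneg hw0 ?_
  nlinarith [mul_nonneg (abs_nonneg s) (sq_nonneg (‖u 0‖ - ‖u 1‖))]

/-- The sesquilinear form `∫ h(ζ) ⟨ρ(ζ) k(ζ), l(ζ)⟩` of the spectral density `ρ`. -/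
def spectralForm (α β : ℂ) (h : Circle → ℂ) (k l : Circle → C2) : ℂ :=
  ∫ ζ, h ζ * inner ℂ (l ζ) (act (density α β ζ) (k ζ)) ∂circleLebesgue

lemma continuous_coord {k : Circle → C2} (hk : Continuous k) (i : Fin 2) :
    Continuous fun ζ => k ζ i :=
  (PiLp.continuous_apply 2 _ i).comp hk

lemma integrable_spectralForm_entry (hα : α ≠ 0) (hα1 : ‖α‖ < 1) {h : Circle → ℂ}
    (hh : Measurable h) {M : ℝ} (hM : ∀ ζ ∈ arcs ‖α‖, ‖h ζ‖ ≤ M) {k l : Circle → C2}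
    (hk : Continuous k) (hl : Continuous l) (i j : Fin 2) :
    Integrable (fun ζ => h ζ * k ζ j * conj (l ζ i) * density α β ζ i j) circleLebesgue := by
  have hkj := continuous_coord hk j
  have hli : Continuous fun ζ => conj (l ζ i) :=
    Complex.continuous_conj.comp (continuous_coord hl i)
  obtain ⟨K, hK⟩ := exists_norm_bound hkj
  obtain ⟨L, hL⟩ := exists_norm_bound hli
  have hK0 := (norm_nonneg _).trans (hK 1)
  refine integrable_mul_density (M := max M 0 * K * L) hα hα1
    (h := fun ζ => h ζ * k ζ j * conj (l ζ i))
    ((hh.mul hkj.measurable).mul hli.measurable) (fun ζ hζ => ?_) i j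
  rw [norm_mul, norm_mul]
  exact mul_le_mul (mul_le_mul ((hM ζ hζ).trans (le_max_left _ _)) (hK ζ) (norm_nonneg _)
    (le_max_right _ _)) (hL ζ) (norm_nonneg _) (by positivity)

lemma mul_inner_act_density (h : Circle → ℂ) (k l : Circle → C2) (ζ : Circle) :
    h ζ * inner ℂ (l ζ) (act (density α β ζ) (k ζ)) =
      ∑ i, ∑ j, h ζ * k ζ j * conj (l ζ i) * density α β ζ i j := by
  rw [inner_act, Finset.mul_sum]
  refine Finset.sum_congr rfl fun i _ => ?_
  rw [Finset.mul_sum]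
  refine Finset.sum_congr rfl fun j _ => ?_
  ring

lemma integrable_spectralForm (hα : α ≠ 0) (hα1 : ‖α‖ < 1) {h : Circle → ℂ}
    (hh : Measurable h) {M : ℝ} (hM : ∀ ζ ∈ arcs ‖α‖, ‖h ζ‖ ≤ M) {k l : Circle → C2}
    (hk : Continuous k) (hl : Continuous l) :
    Integrable (fun ζ => h ζ * inner ℂ (l ζ) (act (density α β ζ) (k ζ))) circleLebesgue := by
  simp only [mul_inner_act_density]
  exact integrable_finsetSum _ fun i _ => integrable_finsetSum _ fun j _ =>
    integrable_spectralForm_entry hα hα1 hh hM hk hl i j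

lemma spectralForm_eq_sum (hα : α ≠ 0) (hα1 : ‖α‖ < 1) {h : Circle → ℂ}
    (hh : Measurable h) {M : ℝ} (hM : ∀ ζ ∈ arcs ‖α‖, ‖h ζ‖ ≤ M) {k l : Circle → C2}
    (hk : Continuous k) (hl : Continuous l) :
    spectralForm α β h k l =
      ∑ i, ∑ j, ∫ ζ, h ζ * k ζ j * conj (l ζ i) * density α β ζ i j ∂circleLebesgue := by
  simp only [spectralForm, mul_inner_act_density]
  rw [integral_finsetSum _ fun i _ => integrable_finsetSum _ fun j _ =>
    integrable_spectralForm_entry hα hα1 hh hM hk hl i j]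
  exact Finset.sum_congr rfl fun i _ => integral_finsetSum _ fun j _ =>
    integrable_spectralForm_entry hα hα1 hh hM hk hl i j

/-- The Fourier transform `∑ₓ F_ζ(x)ᴴ f(x)` of the homogeneous walk on the unit circle, as a linear
map. -/
def fourier (α β : ℂ) (ζ : Circle) : (ℤ →₀ C2) →ₗ[ℂ] C2 :=
  Finsupp.lsum ℂ fun x => actₗ (dualTransfer α β (ζ : ℂ) ^ x)

lemma fourier_single (ζ : Circle) (x : ℤ) (u : C2) :
    fourier α β ζ (Finsupp.single x u) = act (dualTransfer α β (ζ : ℂ) ^ x) u := by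
  rw [fourier, Finsupp.lsum_single, actₗ_apply]

lemma continuous_act {M : Circle → Matrix (Fin 2) (Fin 2) ℂ} (hM : Continuous M) (u : C2) :
    Continuous fun ζ => act (M ζ) u :=
  (PiLp.continuous_toLp 2 _).comp (hM.matrix_mulVec continuous_const)

lemma continuous_fourier (hα : α ≠ 0) (f : ℤ →₀ C2) : Continuous fun ζ => fourier α β ζ f := by
  induction f using Finsupp.induction_linear with
  | zero => simpa using continuous_const
  | add f g hf hg => simp only [map_add]; exact hf.add hg
  | single x u =>
    simp only [fourier_single]
    exact continuous_act (continuous_dualTransfer_zpow hα x) u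

/-- The inclusion of the finitely supported functions into `ℓ²(ℤ, ℂ²)`, as a linear map. -/
def toL2ₗ : (ℤ →₀ C2) →ₗ[ℂ] L2Z :=
  Finsupp.lsum ℂ fun x => lp.lsingle (𝕜 := ℂ) (E := fun _ : ℤ => C2) 2 x

lemma toL2ₗ_apply (f : ℤ →₀ C2) : toL2ₗ f = toL2 f := rfl

lemma toL2_single (x : ℤ) (u : C2) : toL2 (Finsupp.single x u) = lp.single 2 x u := by
  rw [toL2, Finsupp.sum_single_index]
  simp

lemma toL2_add (f g : ℤ →₀ C2) : toL2 (f + g) = toL2 f + toL2 g := map_add toL2ₗ f g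

lemma toL2_zero : toL2 0 = 0 := map_zero toL2ₗ

lemma denseRange_toL2 : DenseRange toL2 := by
  intro f
  refine mem_closure_of_tendsto (lp.hasSum_single (by simp) f)
    (Filter.Eventually.of_forall fun s => ?_)
  refine ⟨∑ x ∈ s, Finsupp.single x (f x), ?_⟩
  rw [← toL2ₗ_apply, map_sum]
  exact Finset.sum_congr rfl fun x _ => toL2_single x (f x)

/-- The Plancherel formula. -/
lemma spectralForm_fourier (hα : α ≠ 0) (hα1 : ‖α‖ < 1) (hab : α * conj α + β * conj β = 1)
    (f g : ℤ →₀ C2) :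
    spectralForm α β (fun _ => 1) (fun ζ => fourier α β ζ f) (fun ζ => fourier α β ζ g) =
      inner ℂ (toL2 g) (toL2 f) := by
  have hint : ∀ f g : ℤ →₀ C2, Integrable (fun ζ => 1 * inner ℂ (fourier α β ζ g)
      (act (density α β ζ) (fourier α β ζ f))) circleLebesgue := fun f g =>
    integrable_spectralForm hα hα1 measurable_const (M := 1) (by simp)
      (continuous_fourier hα f) (continuous_fourier hα g)
  induction f using Finsupp.induction_linear with
  | zero => simp [spectralForm, toL2_zero, act]
  | add f₁ f₂ h₁ h₂ =>
    rw [toL2_add, inner_add_right, ← h₁, ← h₂, spectralForm, spectralForm, spectralForm,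
      ← integral_add (hint f₁ g) (hint f₂ g)]
    simp only [map_add, act_add, inner_add_right, mul_add]
  | single x u =>
    induction g using Finsupp.induction_linear with
    | zero => simp [spectralForm, toL2_zero]
    | add g₁ g₂ h₁ h₂ =>
      rw [toL2_add, inner_add_left, ← h₁, ← h₂, spectralForm, spectralForm, spectralForm,
        ← integral_add (hint _ g₁) (hint _ g₂)]
      simp only [map_add, inner_add_left, mul_add]
    | single y v =>
      have e : ∀ ζ : Circle, (1 : ℂ) * inner ℂ (fourier α β ζ (Finsupp.single y v))
          (act (density α β ζ) (fourier α β ζ (Finsupp.single x u))) =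
          ∑ i, ∑ j, u j * conj (v i) *
            (density α β ζ * dualTransfer α β (ζ : ℂ) ^ (x - y)) i j := by
        intro ζ
        rw [one_mul, fourier_single, fourier_single, ← act_mul, inner_act_act, ← mul_assoc,
          semiconj_density hα hab, inner_act]
      have hi : ∀ i j : Fin 2, Integrable (fun ζ : Circle =>
          (density α β ζ * dualTransfer α β (ζ : ℂ) ^ (x - y)) i j) circleLebesgue := by
        intro i j
        simp only [Matrix.mul_apply]
        refine integrable_finsetSum _ fun m _ => ?_
        have hc : Continuous fun ζ : Circle => (dualTransfer α β (ζ : ℂ) ^ (x - y)) m j :=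
          (continuous_dualTransfer_zpow hα _).matrix_elem m j
        obtain ⟨B, hB⟩ := exists_norm_bound hc
        exact (integrable_mul_density (β := β) hα hα1 hc.measurable (fun ζ _ => hB ζ) i m).congr
          (Filter.Eventually.of_forall fun ζ => mul_comm _ _)
      simp only [spectralForm, e]
      rw [integral_finsetSum _ fun i _ => integrable_finsetSum _ fun j _ =>
        (hi i j).const_mul _]
      simp only [integral_finsetSum _ fun j _ => (hi _ j).const_mul _, integral_const_mul,
        integral_density_mul_zpow hα hα1 hab]
      rw [toL2_single, toL2_single, lp.inner_single_left, lp.single_apply]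
      rcases eq_or_ne x y with rfl | hxy
      · simp [Fin.sum_univ_two, PiLp.inner_apply]
      · simp [sub_eq_zero, hxy, Ne.symm hxy]

end SpectralForm

/-! ### The walk as a multiplication operator, invertibility off the arcs -/

section Operator

open Real Set

/-- The walk with constant coin matrix `M` on finitely supported functions. -/
def step (M : Matrix (Fin 2) (Fin 2) ℂ) : (ℤ →₀ C2) →ₗ[ℂ] (ℤ →₀ C2) :=
  Finsupp.lsum ℂ fun x => Finsupp.lsingle (x - 1) ∘ₗ actₗ (projL * M) +
    Finsupp.lsingle (x + 1) ∘ₗ actₗ (projR * M)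

lemma step_single (M : Matrix (Fin 2) (Fin 2) ℂ) (x : ℤ) (u : C2) :
    step M (Finsupp.single x u) = Finsupp.single (x - 1) (act (projL * M) u) +
      Finsupp.single (x + 1) (act (projR * M) u) := by
  rw [step, Finsupp.lsum_single]
  rfl

lemma act_add_matrix (M N : Matrix (Fin 2) (Fin 2) ℂ) (u : C2) :
    act (M + N) u = act M u + act N u := by
  rw [act, Matrix.add_mulVec, WithLp.toLp_add]; rfl

lemma act_smul_matrix (c : ℂ) (M : Matrix (Fin 2) (Fin 2) ℂ) (u : C2) :
    act (c • M) u = c • act M u := by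
  rw [act, Matrix.smul_mulVec, WithLp.toLp_smul]; rfl

lemma act_one (u : C2) : act 1 u = u := by simp [act]

lemma walk_apply (𝒞 : Coin) (Ψ : L2Z) (x : ℤ) : walk 𝒞 Ψ x = walkMap 𝒞 Ψ x := rfl

lemma act_zero (M : Matrix (Fin 2) (Fin 2) ℂ) : act M 0 = 0 := map_zero (actₗ M)

lemma walk_single (𝒞 : Coin) (x : ℤ) (u : C2) :
    walk 𝒞 (lp.single 2 x u) = lp.single 2 (x - 1) (act (projL * 𝒞 x) u) +
      lp.single 2 (x + 1) (act (projR * 𝒞 x) u) := by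
  ext1
  funext y
  rw [walk_apply, lp.coeFn_add, Pi.add_apply, walkMap]
  congr 1
  · by_cases h : y = x - 1
    · subst h
      rw [lp.single_apply_self, sub_add_cancel, lp.single_apply_self]
    · rw [lp.single_apply_ne _ _ _ (fun h' => h (by omega)), lp.single_apply_ne _ _ _ h, act_zero]
  · by_cases h : y = x + 1
    · subst h
      rw [lp.single_apply_self, add_sub_cancel_right, lp.single_apply_self]
    · rw [lp.single_apply_ne _ _ _ (fun h' => h (by omega)), lp.single_apply_ne _ _ _ h, act_zero]

lemma toL2_step (C : Matrix.specialUnitaryGroup (Fin 2) ℂ) (f : ℤ →₀ C2) :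
    toL2 (step C f) = walk (constCoin C) (toL2 f) := by
  induction f using Finsupp.induction_linear with
  | zero => rw [map_zero, toL2_zero, map_zero]
  | add f g hf hg => rw [map_add, toL2_add, hf, hg, toL2_add, map_add]
  | single x u =>
    rw [step_single, toL2_add, toL2_single, toL2_single, toL2_single, walk_single]
    rfl

lemma projL_add_projR : projL + projR = 1 := by
  ext i j
  fin_cases i <;> fin_cases j <;> simp [projL, projR]

lemma projR_mul_projL : projR * projL = 0 := by
  ext i j
  fin_cases i <;> fin_cases j <;> simp [projL, projR, Matrix.mul_apply]

lemma projL_mul_projR : projL * projR = 0 := by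
  ext i j
  fin_cases i <;> fin_cases j <;> simp [projL, projR, Matrix.mul_apply]

lemma projL_mul_projL : projL * projL = projL := by
  ext i j
  fin_cases i <;> fin_cases j <;> simp [projL, Matrix.mul_apply]

lemma projR_mul_projR : projR * projR = projR := by
  ext i j
  fin_cases i <;> fin_cases j <;> simp [projR, Matrix.mul_apply]

lemma step_surjective (C : Matrix.specialUnitaryGroup (Fin 2) ℂ) :
    Function.Surjective (step (C : Matrix (Fin 2) (Fin 2) ℂ)) := by
  intro f
  have hC : (C : Matrix (Fin 2) (Fin 2) ℂ) * (C : Matrix (Fin 2) (Fin 2) ℂ)ᴴ = 1 :=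
    Matrix.mem_unitaryGroup_iff.1 C.2.1
  have hP : ∀ P Q : Matrix (Fin 2) (Fin 2) ℂ,
      P * (C : Matrix (Fin 2) (Fin 2) ℂ) * ((C : Matrix (Fin 2) (Fin 2) ℂ)ᴴ * Q) = P * Q := by
    intro P Q
    rw [mul_assoc, ← mul_assoc (C : Matrix (Fin 2) (Fin 2) ℂ), hC, one_mul]
  induction f using Finsupp.induction_linear with
  | zero => exact ⟨0, map_zero _⟩
  | add f g hf hg =>
    obtain ⟨a, rfl⟩ := hf
    obtain ⟨b, rfl⟩ := hg
    exact ⟨a + b, map_add _ a b⟩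
  | single x u =>
    refine ⟨Finsupp.single (x + 1) (act ((C : Matrix (Fin 2) (Fin 2) ℂ)ᴴ * projL) u) +
      Finsupp.single (x - 1) (act ((C : Matrix (Fin 2) (Fin 2) ℂ)ᴴ * projR) u), ?_⟩
    rw [map_add, step_single, step_single, ← act_mul, ← act_mul, ← act_mul, ← act_mul, hP, hP, hP,
      hP, projR_mul_projL, projL_mul_projR, projL_mul_projL, projR_mul_projR, act_zero_matrix]
    rw [add_sub_cancel_right, sub_add_cancel, Finsupp.single_zero, Finsupp.single_zero, add_zero,
      zero_add, ← Finsupp.single_add]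
    congr 1
    rw [← act_add_matrix, projL_add_projR, act_one]

variable {α β : ℂ} {C : Matrix.specialUnitaryGroup (Fin 2) ℂ}

lemma coin_relation (hC : (C : Matrix (Fin 2) (Fin 2) ℂ) = !![α, β; -conj β, conj α]) :
    α * conj α + β * conj β = 1 := by
  have h := (Matrix.mem_specialUnitaryGroup_iff.1 C.2).2
  rw [hC, Matrix.det_fin_two_of] at h
  linear_combination h

lemma norm_lt_one_of_coin_relation (hβ : β ≠ 0) (hab : α * conj α + β * conj β = 1) :
    ‖α‖ < 1 := by
  rw [Complex.mul_conj', Complex.mul_conj'] at hab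
  have h : ‖α‖ ^ 2 + ‖β‖ ^ 2 = 1 := by exact_mod_cast hab
  have := norm_pos_iff.2 hβ
  nlinarith [norm_nonneg α]

/-- The Fourier transform turns the walk into multiplication by `ζ`. -/
lemma fourier_step (hC : (C : Matrix (Fin 2) (Fin 2) ℂ) = !![α, β; -conj β, conj α])
    (hα : α ≠ 0) (ζ : Circle) (f : ℤ →₀ C2) :
    fourier α β ζ (step C f) = (ζ : ℂ) • fourier α β ζ f := by
  have hab := coin_relation hC
  have hu := isUnit_det_dualTransfer (β := β) hα (Circle.norm_coe ζ)
  induction f using Finsupp.induction_linear with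
  | zero => simp
  | add f g hf hg => rw [map_add, map_add, hf, hg, map_add, smul_add]
  | single x u =>
    rw [step_single, map_add, fourier_single, fourier_single, fourier_single, ← act_mul, ← act_mul]
    have e : dualTransfer α β (ζ : ℂ) ^ (x - 1) * (projL * (C : Matrix (Fin 2) (Fin 2) ℂ)) +
        dualTransfer α β (ζ : ℂ) ^ (x + 1) * (projR * (C : Matrix (Fin 2) (Fin 2) ℂ)) =
        (ζ : ℂ) • dualTransfer α β (ζ : ℂ) ^ x := by
      have h0 : dualTransfer α β (ζ : ℂ) ^ (x - 1) * dualTransfer α β (ζ : ℂ) =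
          dualTransfer α β (ζ : ℂ) ^ x := by
        rw [← Matrix.zpow_add_one hu, sub_add_cancel]
      have h1 : dualTransfer α β (ζ : ℂ) ^ (x + 1) = dualTransfer α β (ζ : ℂ) ^ (x - 1) *
          (dualTransfer α β (ζ : ℂ) * dualTransfer α β (ζ : ℂ)) := by
        rw [Matrix.zpow_add_one hu, ← h0, mul_assoc]
      have h := congrArg (dualTransfer α β (ζ : ℂ) ^ (x - 1) * ·)
        (dualTransfer_eigen hα hab (Circle.norm_coe ζ))
      simp only [mul_add, mul_smul_comm] at h
      rw [h0, ← mul_assoc _ (dualTransfer α β (ζ : ℂ) * dualTransfer α β (ζ : ℂ)), ← h1] at h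
      rw [hC]
      exact h
    rw [← act_add_matrix, e, act_smul_matrix]

/-- The spectral density of `f`: the density of the measure `⟨dE(ζ) f, f⟩`. -/
def energy (α β : ℂ) (f : ℤ →₀ C2) (ζ : Circle) : ℝ :=
  (inner ℂ (fourier α β ζ f) (act (density α β ζ) (fourier α β ζ f))).re

lemma inner_act_density_self (hα : α ≠ 0) (hab : α * conj α + β * conj β = 1)
    (f : ℤ →₀ C2) (ζ : Circle) :
    inner ℂ (fourier α β ζ f) (act (density α β ζ) (fourier α β ζ f)) =
      (energy α β f ζ : ℂ) := by
  have h := (posSemidef_iff_inner _ (conjTranspose_density ζ)).1 (posSemidef_density hα hab ζ)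
    (fourier α β ζ f)
  exact (Complex.eq_re_of_ofReal_le h)

lemma energy_nonneg (hα : α ≠ 0) (hab : α * conj α + β * conj β = 1)
    (f : ℤ →₀ C2) (ζ : Circle) : 0 ≤ energy α β f ζ := by
  have h := (posSemidef_iff_inner _ (conjTranspose_density ζ)).1 (posSemidef_density hα hab ζ)
    (fourier α β ζ f)
  rw [inner_act_density_self hα hab] at h
  exact_mod_cast h

lemma energy_eq_zero (f : ℤ →₀ C2) {ζ : Circle} (hζ : ζ ∉ arcs ‖α‖) : energy α β f ζ = 0 := by
  rw [energy, density, indicator_of_notMem hζ, act_zero_matrix, inner_zero_right, Complex.zero_re]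

lemma integrable_energy (hα : α ≠ 0) (hα1 : ‖α‖ < 1) (f : ℤ →₀ C2) :
    Integrable (energy α β f) circleLebesgue := by
  have h := (integrable_spectralForm (β := β) hα hα1 (h := fun _ => 1) measurable_const (M := 1)
    (by simp) (continuous_fourier (β := β) hα f) (continuous_fourier (β := β) hα f)).re
  simp only [one_mul] at h
  exact h

lemma norm_sq_toL2 (hα : α ≠ 0) (hα1 : ‖α‖ < 1) (hab : α * conj α + β * conj β = 1)
    (f : ℤ →₀ C2) : ‖toL2 f‖ ^ 2 = ∫ ζ, energy α β f ζ ∂circleLebesgue := by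
  have h := spectralForm_fourier hα hα1 hab f f
  rw [inner_self_eq_norm_sq_to_K, spectralForm] at h
  simp only [inner_act_density_self hα hab, one_mul, integral_complex_ofReal] at h
  exact Complex.ofReal_injective (by simpa using h.symm)

lemma toL2_sub_smul (f : ℤ →₀ C2) (l : ℂ) :
    toL2 (step C f - l • f) =
      (walk (constCoin C) - algebraMap ℂ (L2Z →L[ℂ] L2Z) l) (toL2 f) := by
  rw [← toL2ₗ_apply, map_sub, map_smul, toL2ₗ_apply, toL2ₗ_apply, toL2_step,
    Algebra.algebraMap_eq_smul_one]
  rfl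

lemma fourier_sub_smul (hC : (C : Matrix (Fin 2) (Fin 2) ℂ) = !![α, β; -conj β, conj α])
    (hα : α ≠ 0) (ζ : Circle) (f : ℤ →₀ C2) (l : ℂ) :
    fourier α β ζ (step C f - l • f) = ((ζ : ℂ) - l) • fourier α β ζ f := by
  rw [map_sub, map_smul, fourier_step hC hα, sub_smul]

lemma energy_sub_smul (hC : (C : Matrix (Fin 2) (Fin 2) ℂ) = !![α, β; -conj β, conj α])
    (hα : α ≠ 0) (ζ : Circle) (f : ℤ →₀ C2) (l : ℂ) :
    energy α β (step C f - l • f) ζ = ‖(ζ : ℂ) - l‖ ^ 2 * energy α β f ζ := by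
  have h : conj ((ζ : ℂ) - l) * ((ζ : ℂ) - l) = ((‖(ζ : ℂ) - l‖ ^ 2 : ℝ) : ℂ) := by
    rw [Complex.conj_mul']; push_cast; rfl
  rw [energy, fourier_sub_smul hC hα, act_smul, inner_smul_left, inner_smul_right, ← mul_assoc, h,
    Complex.re_ofReal_mul, energy]

lemma exists_dist_le_of_notMem {l : ℂ} (hl : l ∉ {ζ : ℂ | ‖ζ‖ = 1 ∧ |ζ.re| ≤ ‖α‖}) :
    ∃ δ : ℝ, 0 < δ ∧ ∀ ζ ∈ arcs ‖α‖, δ ≤ ‖(ζ : ℂ) - l‖ := by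
  have hc : Continuous fun ζ : Circle => ‖(ζ : ℂ) - l‖ :=
    (Continuous.sub continuous_subtype_val continuous_const).norm
  refine (isClosed_arcs ‖α‖).isCompact.exists_forall_le' hc.continuousOn fun ζ hζ => ?_
  refine norm_pos_iff.2 fun h => hl ?_
  rw [← sub_eq_zero.1 h]
  exact ⟨Circle.norm_coe ζ, hζ⟩

/-- By the Plancherel formula, `U - l` is bounded below by the distance of `l` to the arcs. -/
lemma mul_norm_le_norm_sub (hC : (C : Matrix (Fin 2) (Fin 2) ℂ) = !![α, β; -conj β, conj α])
    (hα : α ≠ 0) (hβ : β ≠ 0) {l : ℂ} {δ : ℝ} (hδ : 0 < δ)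
    (h : ∀ ζ ∈ arcs ‖α‖, δ ≤ ‖(ζ : ℂ) - l‖) (Ψ : L2Z) :
    δ * ‖Ψ‖ ≤ ‖(walk (constCoin C) - algebraMap ℂ (L2Z →L[ℂ] L2Z) l) Ψ‖ := by
  have hab := coin_relation hC
  have hα1 := norm_lt_one_of_coin_relation hβ hab
  refine denseRange_toL2.induction_on Ψ
    (isClosed_le (by fun_prop) (by fun_prop)) fun f => ?_
  refine le_of_sq_le_sq ?_ (norm_nonneg _)
  rw [← toL2_sub_smul, mul_pow, norm_sq_toL2 hα hα1 hab, norm_sq_toL2 hα hα1 hab,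
    ← integral_const_mul]
  refine integral_mono ((integrable_energy hα hα1 f).const_mul _) (integrable_energy hα hα1 _)
    fun ζ => ?_
  beta_reduce
  rw [energy_sub_smul hC hα]
  by_cases hζ : ζ ∈ arcs ‖α‖
  · exact mul_le_mul_of_nonneg_right (pow_le_pow_left₀ hδ.le (h ζ hζ) 2) (energy_nonneg hα hab f ζ)
  · rw [energy_eq_zero f hζ, mul_zero, mul_zero]

lemma norm_walk (hC : (C : Matrix (Fin 2) (Fin 2) ℂ) = !![α, β; -conj β, conj α])
    (hα : α ≠ 0) (hβ : β ≠ 0) (Ψ : L2Z) : ‖walk (constCoin C) Ψ‖ = ‖Ψ‖ := by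
  have hab := coin_relation hC
  have hα1 := norm_lt_one_of_coin_relation hβ hab
  refine denseRange_toL2.induction_on Ψ
    (isClosed_eq (by fun_prop) (by fun_prop)) fun f => ?_
  refine (pow_left_inj₀ (norm_nonneg _) (norm_nonneg _) two_ne_zero).1 ?_
  rw [← toL2_step, norm_sq_toL2 hα hα1 hab, norm_sq_toL2 hα hα1 hab]
  refine integral_congr_ae (Filter.Eventually.of_forall fun ζ => ?_)
  have := energy_sub_smul hC hα ζ f 0
  rw [zero_smul, sub_zero, sub_zero, Circle.norm_coe, one_pow, one_mul] at this
  exact this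

/-- The walk is unitary: it is isometric by the Plancherel formula, and its range contains the
finitely supported functions. Hence `U - l` is normal. -/
lemma isStarNormal_walk_sub (hC : (C : Matrix (Fin 2) (Fin 2) ℂ) = !![α, β; -conj β, conj α])
    (hα : α ≠ 0) (hβ : β ≠ 0) (l : ℂ) :
    IsStarNormal (walk (constCoin C) - algebraMap ℂ (L2Z →L[ℂ] L2Z) l) := by
  have hiso : Isometry (walk (constCoin C)) :=
    AddMonoidHomClass.isometry_of_norm _ (norm_walk hC hα hβ)
  have h1 : star (walk (constCoin C)) * walk (constCoin C) = 1 :=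
    (ContinuousLinearMap.norm_map_iff_adjoint_comp_self _).1 (norm_walk hC hα hβ)
  have hsurj : Function.Surjective (walk (constCoin C)) := by
    rw [← Set.range_eq_univ, ← hiso.isClosedEmbedding.isClosed_range.closure_eq]
    refine Dense.closure_eq (denseRange_toL2.mono ?_)
    rintro _ ⟨f, rfl⟩
    obtain ⟨g, rfl⟩ := step_surjective C f
    exact ⟨toL2 g, (toL2_step C g).symm⟩
  have hunit : IsUnit (walk (constCoin C)) :=
    ContinuousLinearMap.isUnit_iff_bijective.2 ⟨hiso.injective, hsurj⟩
  have h2 := (Unitary.mem_iff.1 (IsUnit.mem_unitary_of_star_mul_self hunit h1)).2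
  have hcomm := Algebra.commutes (R := ℂ) (A := L2Z →L[ℂ] L2Z)
  refine ⟨?_⟩
  rw [Commute, SemiconjBy, star_sub, ← algebraMap_star_comm, sub_mul, sub_mul, mul_sub, mul_sub,
    mul_sub, mul_sub, h1, h2, hcomm (star l) (walk _), hcomm l (star (walk _)),
    hcomm (star l) (algebraMap _ _ l)]
  abel

/-- A normal operator which is bounded below is invertible. -/
lemma isUnit_walk_sub (hC : (C : Matrix (Fin 2) (Fin 2) ℂ) = !![α, β; -conj β, conj α])
    (hα : α ≠ 0) (hβ : β ≠ 0) {l : ℂ} (hl : l ∉ {ζ : ℂ | ‖ζ‖ = 1 ∧ |ζ.re| ≤ ‖α‖}) :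
    IsUnit (walk (constCoin C) - algebraMap ℂ (L2Z →L[ℂ] L2Z) l) := by
  obtain ⟨δ, hδ, h⟩ := exists_dist_le_of_notMem hl
  have hb := mul_norm_le_norm_sub hC hα hβ hδ h
  set A := walk (constCoin C) - algebraMap ℂ (L2Z →L[ℂ] L2Z) l with hA
  have hanti : AntilipschitzWith (Real.toNNReal δ⁻¹) A := by
    refine ContinuousLinearMap.antilipschitz_of_bound A fun Ψ => ?_
    rw [Real.coe_toNNReal _ (by positivity), ← div_eq_inv_mul, le_div_iff₀ hδ, mul_comm]
    exact hb Ψ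
  refine ContinuousLinearMap.isUnit_iff_bijective.2
    ((ContinuousLinearMap.bijective_iff_dense_range_and_antilipschitz A).2 ⟨?_, _, hanti⟩)
  rw [Submodule.topologicalClosure_eq_top_iff,
    ContinuousLinearMap.IsStarNormal.orthogonal_range (isStarNormal_walk_sub hC hα hβ l)]
  exact LinearMap.ker_eq_bot.2 hanti.injective

end Operator

/-! ### Approximate eigenvectors on the arcs -/

section Weyl

open Real Set

variable {α β : ℂ} {C : Matrix.specialUnitaryGroup (Fin 2) ℂ}

lemma exists_re_mul_eq (hα : α ≠ 0) {t : ℝ} (ht : |t| ≤ ‖α‖) :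
    ∃ μ : ℂ, ‖μ‖ = 1 ∧ (μ * α).re = t := by
  have h0 : t ^ 2 ≤ ‖α‖ ^ 2 := by
    rw [← sq_abs t]; exact pow_le_pow_left₀ (abs_nonneg _) ht 2
  have hw : ‖(⟨t, √(‖α‖ ^ 2 - t ^ 2)⟩ : ℂ)‖ = ‖α‖ := by
    refine (pow_left_inj₀ (norm_nonneg _) (norm_nonneg _) two_ne_zero).1 ?_
    rw [Complex.sq_norm, Complex.normSq_mk, ← sq, ← sq, Real.sq_sqrt (by linarith)]
    ring
  refine ⟨⟨t, √(‖α‖ ^ 2 - t ^ 2)⟩ / α, ?_, ?_⟩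
  · rw [norm_div, hw, div_self (norm_ne_zero_iff.2 hα)]
  · rw [div_mul_cancel₀ _ hα]

/-- For `l` on the arcs the eigenvalue equation `U Ψ = l Ψ` has a bounded solution, namely a plane
wave `Ψ(x) = μˣ u`. -/
lemma exists_plane_wave (hC : (C : Matrix (Fin 2) (Fin 2) ℂ) = !![α, β; -conj β, conj α])
    (hα : α ≠ 0) {l : ℂ} (hl : ‖l‖ = 1) (hl' : |l.re| ≤ ‖α‖) :
    ∃ (μ : ℂ) (u : C2), ‖μ‖ = 1 ∧ u ≠ 0 ∧
      l • u = μ • act (projL * C) u + μ⁻¹ • act (projR * C) u := by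
  have hab := coin_relation hC
  obtain ⟨μ, hμ, hre⟩ := exists_re_mul_eq hα hl'
  have hμ0 : μ ≠ 0 := by rintro rfl; simp at hμ
  have hinv : μ⁻¹ = conj μ := Complex.inv_eq_conj hμ
  have h1 : μ * α + μ⁻¹ * conj α = l + conj l := by
    rw [hinv, ← map_mul, Complex.add_conj, Complex.add_conj, hre]
  have h2 : l * conj l = 1 := by rw [Complex.mul_conj', hl]; simp
  set N : Matrix (Fin 2) (Fin 2) ℂ :=
    μ • (projL * (C : Matrix (Fin 2) (Fin 2) ℂ)) + μ⁻¹ • (projR * (C : Matrix (Fin 2) (Fin 2) ℂ)) -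
      l • 1 with hN
  have hdet : N.det = 0 := by
    have e : N = !![μ * α - l, μ * β; -(μ⁻¹ * conj β), μ⁻¹ * conj α - l] := by
      rw [hN, hC]
      ext i j
      fin_cases i <;> fin_cases j <;> simp [projL, projR]
    rw [e, Matrix.det_fin_two_of]
    have h3 : μ * μ⁻¹ = 1 := mul_inv_cancel₀ hμ0
    linear_combination hab + (α * conj α + β * conj β) * h3 - l * h1 - h2
  obtain ⟨v, hv, hNv⟩ := Matrix.exists_mulVec_eq_zero_iff.2 hdet
  refine ⟨μ, WithLp.toLp 2 v, hμ, fun h => hv (by simpa using h), ?_⟩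
  have h : act N (WithLp.toLp 2 v) = 0 := by
    rw [act, hNv]; rfl
  have e : μ • (projL * (C : Matrix (Fin 2) (Fin 2) ℂ)) +
      μ⁻¹ • (projR * (C : Matrix (Fin 2) (Fin 2) ℂ)) = N + l • 1 := by rw [hN, sub_add_cancel]
  rw [← act_smul_matrix, ← act_smul_matrix, ← act_add_matrix, e, act_add_matrix, h, zero_add,
    act_smul_matrix, act_one]

/-- The plane wave `μˣ u`, cut off to `0 ≤ x < N`. -/
def truncatedWave (μ : ℂ) (u : C2) (N : ℕ) : ℤ →₀ C2 :=
  ∑ x ∈ Finset.range N, Finsupp.single (x : ℤ) (μ ^ x • u)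

lemma norm_sq_truncatedWave {μ : ℂ} (hμ : ‖μ‖ = 1) (u : C2) (N : ℕ) :
    ‖toL2 (truncatedWave μ u N)‖ ^ 2 = N * ‖u‖ ^ 2 := by
  induction N with
  | zero => simp [truncatedWave, toL2_zero]
  | succ N ih =>
    have h : inner ℂ (toL2 (truncatedWave μ u N))
        (toL2 (Finsupp.single (N : ℤ) (μ ^ N • u))) = 0 := by
      rw [truncatedWave, ← toL2ₗ_apply, map_sum, sum_inner]
      refine Finset.sum_eq_zero fun x hx => ?_
      have hx' : (x : ℤ) ≠ N := by
        have := Finset.mem_range.1 hx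
        omega
      rw [toL2ₗ_apply, toL2_single, toL2_single, lp.inner_single_left, lp.single_apply_ne _ _ _ hx',
        inner_zero_right]
    have hs : truncatedWave μ u (N + 1) =
        truncatedWave μ u N + Finsupp.single (N : ℤ) (μ ^ N • u) := Finset.sum_range_succ _ _
    have hn := norm_add_sq_eq_norm_sq_add_norm_sq_of_inner_eq_zero _ _ h
    rw [hs, toL2_add, sq, hn, ← sq, ← sq, ih, toL2_single, lp.norm_single (by simp), norm_smul,
      norm_pow, hμ]
    push_cast
    ring

/-- Cutting off a generalized eigenfunction leaves only boundary terms, of norm bounded in `N`. -/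
lemma norm_walk_sub_truncatedWave_le {μ l : ℂ} {u : C2} (hμ : ‖μ‖ = 1)
    (h : l • u = μ • act (projL * C) u + μ⁻¹ • act (projR * C) u) (N : ℕ) :
    ‖(walk (constCoin C) - algebraMap ℂ (L2Z →L[ℂ] L2Z) l) (toL2 (truncatedWave μ u N))‖ ≤
      2 * ‖act (projL * (C : Matrix (Fin 2) (Fin 2) ℂ)) u‖ +
        2 * ‖act (projR * (C : Matrix (Fin 2) (Fin 2) ℂ)) u‖ := by
  have hμ0 : μ ≠ 0 := by rintro rfl; simp at hμ
  set a := act (projL * (C : Matrix (Fin 2) (Fin 2) ℂ)) u with ha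
  set b := act (projR * (C : Matrix (Fin 2) (Fin 2) ℂ)) u with hb
  set A : ℕ → ℤ →₀ C2 := fun x => Finsupp.single ((x : ℤ) - 1) (μ ^ x • a) with hA
  set B : ℕ → ℤ →₀ C2 := fun x => Finsupp.single (x : ℤ) ((μ⁻¹ * μ ^ x) • b) with hB
  have hnA : ∀ x, ‖toL2 (A x)‖ = ‖a‖ := fun x => by
    rw [hA, toL2_single, lp.norm_single (by simp), norm_smul, norm_pow, hμ, one_pow, one_mul]
  have hnB : ∀ x, ‖toL2 (B x)‖ = ‖b‖ := fun x => by
    rw [hB, toL2_single, lp.norm_single (by simp), norm_smul, norm_mul, norm_inv, norm_pow, hμ,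
      one_pow, inv_one, one_mul, one_mul]
  have key : step C (truncatedWave μ u N) - l • truncatedWave μ u N =
      (B N - B 0) - (A N - A 0) := by
    rw [truncatedWave, map_sum, Finset.smul_sum, ← Finset.sum_sub_distrib, ← Finset.sum_range_sub A,
      ← Finset.sum_range_sub B, ← Finset.sum_sub_distrib]
    refine Finset.sum_congr rfl fun x _ => ?_
    have e : l • μ ^ x • u = μ ^ (x + 1) • a + (μ⁻¹ * μ ^ x) • b := by
      rw [smul_comm, h, smul_add, smul_smul, smul_smul, pow_succ, mul_comm μ⁻¹]
    have e' : μ⁻¹ * μ ^ (x + 1) = μ ^ x := by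
      rw [pow_succ]; field_simp
    simp only [hA, hB]
    rw [step_single, Finsupp.smul_single, e, act_smul, act_smul, ← ha, ← hb, Finsupp.single_add, e']
    push_cast
    rw [add_sub_cancel_right]
    abel
  rw [← toL2_sub_smul, key, ← toL2ₗ_apply, map_sub, map_sub, map_sub]
  simp only [toL2ₗ_apply]
  refine (norm_sub_le _ _).trans ?_
  have h1 := norm_sub_le (toL2 (B N)) (toL2 (B 0))
  have h2 := norm_sub_le (toL2 (A N)) (toL2 (A 0))
  rw [hnA, hnA] at h2
  rw [hnB, hnB] at h1
  linarith

/-- The truncated plane waves are approximate eigenvectors, so that `l` is in the spectrum. -/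
lemma not_isUnit_walk_sub (hC : (C : Matrix (Fin 2) (Fin 2) ℂ) = !![α, β; -conj β, conj α])
    (hα : α ≠ 0) {l : ℂ} (hl : ‖l‖ = 1) (hl' : |l.re| ≤ ‖α‖) :
    ¬ IsUnit (walk (constCoin C) - algebraMap ℂ (L2Z →L[ℂ] L2Z) l) := by
  rintro ⟨V, hV⟩
  obtain ⟨μ, u, hμ, hu, h⟩ := exists_plane_wave hC hα hl hl'
  set K := ‖(↑V⁻¹ : L2Z →L[ℂ] L2Z)‖ * (2 * ‖act (projL * (C : Matrix (Fin 2) (Fin 2) ℂ)) u‖ +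
        2 * ‖act (projR * (C : Matrix (Fin 2) (Fin 2) ℂ)) u‖) with hK
  have hbound : ∀ N : ℕ, N * ‖u‖ ^ 2 ≤ K ^ 2 := by
    intro N
    rw [← norm_sq_truncatedWave hμ]
    refine pow_le_pow_left₀ (norm_nonneg _) ?_ 2
    have e : (↑V⁻¹ : L2Z →L[ℂ] L2Z) ((V : L2Z →L[ℂ] L2Z) (toL2 (truncatedWave μ u N))) =
        toL2 (truncatedWave μ u N) :=
      congrArg (fun T : L2Z →L[ℂ] L2Z => T (toL2 (truncatedWave μ u N))) (Units.inv_mul V)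
    rw [← e]
    refine (ContinuousLinearMap.le_opNorm _ _).trans (mul_le_mul_of_nonneg_left ?_ (norm_nonneg _))
    rw [hV]
    exact norm_walk_sub_truncatedWave_le hμ h N
  have hu0 : 0 < ‖u‖ ^ 2 := by have := norm_pos_iff.2 hu; positivity
  obtain ⟨N, hN⟩ := exists_nat_gt (K ^ 2 / ‖u‖ ^ 2)
  rw [div_lt_iff₀ hu0] at hN
  exact absurd (hbound N) (not_le.2 hN)

lemma spectrum_walk (hC : (C : Matrix (Fin 2) (Fin 2) ℂ) = !![α, β; -conj β, conj α])
    (hα : α ≠ 0) (hβ : β ≠ 0) :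
    spectrum ℂ (walk (constCoin C)) = {ζ : ℂ | ‖ζ‖ = 1 ∧ |ζ.re| ≤ ‖α‖} := by
  ext l
  rw [spectrum.mem_iff, ← IsUnit.neg_iff, neg_sub]
  constructor
  · intro h
    by_contra hl
    exact h (isUnit_walk_sub hC hα hβ hl)
  · rintro ⟨h1, h2⟩
    exact not_isUnit_walk_sub hC hα h1 h2

end Weyl

/-! ### Spectral representation of the resolvent -/

section Resolvent

open Real Set

variable {α β : ℂ} {C : Matrix.specialUnitaryGroup (Fin 2) ℂ}

/-- Cauchy–Schwarz, in additive form, for the form of a positive semidefinite matrix. -/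
lemma two_mul_norm_inner_act_le {M : Matrix (Fin 2) (Fin 2) ℂ} (hM : M.PosSemidef) (u v : C2) :
    2 * ‖inner ℂ v (act M u)‖ ≤ (inner ℂ u (act M u)).re + (inner ℂ v (act M v)).re := by
  have hH : Mᴴ = M := hM.isHermitian
  have hpos := fun w => (Complex.nonneg_iff.1 ((posSemidef_iff_inner M hH).1 hM w)).1
  set z := inner ℂ v (act M u) with hz
  have hconj : inner ℂ u (act M v) = conj z := by
    have h := inner_act_act 1 M v u
    rw [act_one, mul_one, hH] at h
    rw [← h, hz, inner_conj_symm]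
  rcases eq_or_ne z 0 with h0 | h0
  · rw [h0, norm_zero, mul_zero]
    exact add_nonneg (hpos u) (hpos v)
  have hn : (‖z‖ : ℂ) ≠ 0 := by exact_mod_cast norm_ne_zero_iff.2 h0
  -- the phase `p` of `z` makes the cross terms equal to `-‖z‖`
  set p : ℂ := z / ‖z‖ with hp
  have h1 : p * conj z = (‖z‖ : ℂ) := by
    rw [hp, div_mul_eq_mul_div, Complex.mul_conj', sq, mul_div_cancel_right₀ _ hn]
  have h2 : conj p * z = (‖z‖ : ℂ) := by
    have := congrArg conj h1
    simpa using this
  have h3 : conj p * p = 1 := by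
    rw [hp, ← mul_div_assoc, h2, div_self hn]
  have h := hpos (u - p • v)
  have e : inner ℂ (u - p • v) (act M (u - p • v)) =
      inner ℂ u (act M u) - p * conj z - conj p * z + conj p * p * inner ℂ v (act M v) := by
    rw [← actₗ_apply, map_sub, map_smul, actₗ_apply, actₗ_apply, inner_sub_left, inner_sub_right,
      inner_sub_right, inner_smul_left, inner_smul_left, inner_smul_right, inner_smul_right, hconj,
      ← hz]
    ring
  rw [e, h1, h2, h3, one_mul] at h
  simp at h
  linarith

lemma two_mul_norm_inner_fourier_le (hα : α ≠ 0) (hab : α * conj α + β * conj β = 1)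
    (f g : ℤ →₀ C2) (ζ : Circle) :
    2 * ‖inner ℂ (fourier α β ζ g) (act (density α β ζ) (fourier α β ζ f))‖ ≤
      energy α β f ζ + energy α β g ζ :=
  two_mul_norm_inner_act_le (posSemidef_density hα hab ζ) _ _

/-- The spectral representation of the form of `(U - l)⁻¹`. -/
def resolventForm (α β l : ℂ) (f g : ℤ →₀ C2) : ℂ :=
  spectralForm α β (fun ζ => ((ζ : ℂ) - l)⁻¹) (fun ζ => fourier α β ζ f)
    (fun ζ => fourier α β ζ g)

lemma measurable_inv_coe_sub (l : ℂ) : Measurable fun ζ : Circle => ((ζ : ℂ) - l)⁻¹ := by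
  have h : Continuous fun ζ : Circle => (ζ : ℂ) - l :=
    Continuous.sub continuous_subtype_val continuous_const
  exact h.measurable.inv

lemma norm_inv_coe_sub_le {l : ℂ} {δ : ℝ} (hδ : 0 < δ)
    (h : ∀ ζ ∈ arcs ‖α‖, δ ≤ ‖(ζ : ℂ) - l‖) : ∀ ζ ∈ arcs ‖α‖, ‖((ζ : ℂ) - l)⁻¹‖ ≤ δ⁻¹ := by
  intro ζ hζ
  rw [norm_inv]
  exact inv_anti₀ hδ (h ζ hζ)

lemma integrable_resolventForm (hα : α ≠ 0) (hα1 : ‖α‖ < 1) {l : ℂ} {δ : ℝ} (hδ : 0 < δ)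
    (h : ∀ ζ ∈ arcs ‖α‖, δ ≤ ‖(ζ : ℂ) - l‖) (f g : ℤ →₀ C2) :
    Integrable (fun ζ : Circle => ((ζ : ℂ) - l)⁻¹ *
      inner ℂ (fourier α β ζ g) (act (density α β ζ) (fourier α β ζ f))) circleLebesgue :=
  integrable_spectralForm hα hα1 (measurable_inv_coe_sub l) (norm_inv_coe_sub_le hδ h)
    (continuous_fourier hα f) (continuous_fourier hα g)

lemma resolventForm_add (hα : α ≠ 0) (hα1 : ‖α‖ < 1) {l : ℂ} {δ : ℝ} (hδ : 0 < δ)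
    (h : ∀ ζ ∈ arcs ‖α‖, δ ≤ ‖(ζ : ℂ) - l‖) (f₁ f₂ g : ℤ →₀ C2) :
    resolventForm α β l (f₁ + f₂) g = resolventForm α β l f₁ g + resolventForm α β l f₂ g := by
  rw [resolventForm, resolventForm, resolventForm, spectralForm, spectralForm, spectralForm,
    ← integral_add (integrable_resolventForm hα hα1 hδ h f₁ g)
      (integrable_resolventForm hα hα1 hδ h f₂ g)]
  simp only [map_add, act_add, inner_add_right, mul_add]

lemma resolventForm_smul (l c : ℂ) (f g : ℤ →₀ C2) :
    resolventForm α β l (c • f) g = c * resolventForm α β l f g := by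
  rw [resolventForm, resolventForm, spectralForm, spectralForm, ← integral_const_mul]
  simp only [map_smul, act_smul, inner_smul_right]
  congr 1
  funext ζ
  ring

lemma resolventForm_sub_smul (hC : (C : Matrix (Fin 2) (Fin 2) ℂ) = !![α, β; -conj β, conj α])
    (hα : α ≠ 0) (hα1 : ‖α‖ < 1) {l : ℂ} {δ : ℝ} (hδ : 0 < δ)
    (h : ∀ ζ ∈ arcs ‖α‖, δ ≤ ‖(ζ : ℂ) - l‖) (f g : ℤ →₀ C2) :
    resolventForm α β l (step C f - l • f) g = inner ℂ (toL2 g) (toL2 f) := by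
  rw [← spectralForm_fourier hα hα1 (coin_relation hC), resolventForm, spectralForm, spectralForm]
  congr 1
  funext ζ
  by_cases hζ : ζ ∈ arcs ‖α‖
  · have hne : (ζ : ℂ) - l ≠ 0 := norm_pos_iff.1 (hδ.trans_le (h ζ hζ))
    rw [fourier_sub_smul hC hα, act_smul, inner_smul_right, ← mul_assoc, inv_mul_cancel₀ hne]
  · rw [density, indicator_of_notMem hζ, act_zero_matrix, act_zero_matrix, inner_zero_right,
      mul_zero, mul_zero]

lemma norm_resolventForm_le (hα : α ≠ 0) (hα1 : ‖α‖ < 1) (hab : α * conj α + β * conj β = 1)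
    {l : ℂ} {δ : ℝ} (hδ : 0 < δ) (h : ∀ ζ ∈ arcs ‖α‖, δ ≤ ‖(ζ : ℂ) - l‖) (f g : ℤ →₀ C2) :
    ‖resolventForm α β l f g‖ ≤ δ⁻¹ * (‖toL2 f‖ ^ 2 + ‖toL2 g‖ ^ 2) := by
  rw [norm_sq_toL2 hα hα1 hab, norm_sq_toL2 hα hα1 hab,
    ← integral_add (integrable_energy hα hα1 f) (integrable_energy hα hα1 g), ← integral_const_mul]
  refine (norm_integral_le_integral_norm _).trans (integral_mono
    (integrable_resolventForm hα hα1 hδ h f g).norm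
    (((integrable_energy hα hα1 f).add (integrable_energy hα hα1 g)).const_mul _) fun ζ => ?_)
  beta_reduce
  have hE := two_mul_norm_inner_fourier_le hα hab f g ζ
  have hδ' := inv_pos.2 hδ
  have h0 := norm_nonneg (inner ℂ (fourier α β ζ g) (act (density α β ζ) (fourier α β ζ f)))
  by_cases hζ : ζ ∈ arcs ‖α‖
  · rw [norm_mul]
    refine mul_le_mul (norm_inv_coe_sub_le hδ h ζ hζ) ?_ (norm_nonneg _) hδ'.le
    linarith
  · rw [density, indicator_of_notMem hζ, act_zero_matrix, inner_zero_right, mul_zero, norm_zero]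
    exact mul_nonneg hδ'.le (by linarith)

lemma norm_resolventForm_le_of_norm_le (hα : α ≠ 0) (hα1 : ‖α‖ < 1)
    (hab : α * conj α + β * conj β = 1) {l : ℂ} {δ : ℝ} (hδ : 0 < δ)
    (h : ∀ ζ ∈ arcs ‖α‖, δ ≤ ‖(ζ : ℂ) - l‖) {f : ℤ →₀ C2} (g : ℤ →₀ C2) {η : ℝ} (hη : 0 < η)
    (hf : ‖toL2 f‖ ≤ η) :
    ‖resolventForm α β l f g‖ ≤ δ⁻¹ * (1 + ‖toL2 g‖ ^ 2) * η := by
  have h1 := norm_resolventForm_le hα hα1 hab hδ h (((η⁻¹ : ℝ) : ℂ) • f) g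
  have hs : ‖toL2 (((η⁻¹ : ℝ) : ℂ) • f)‖ ≤ 1 := by
    rw [← toL2ₗ_apply, map_smul, toL2ₗ_apply, norm_smul, Complex.norm_real, Real.norm_eq_abs,
      abs_of_pos (inv_pos.2 hη), ← div_eq_inv_mul, div_le_one hη]
    exact hf
  have hs2 := pow_le_one₀ (n := 2) (norm_nonneg _) hs
  rw [resolventForm_smul, norm_mul, Complex.norm_real, Real.norm_eq_abs,
    abs_of_pos (inv_pos.2 hη), ← div_eq_inv_mul, div_le_iff₀ hη] at h1
  refine h1.trans (mul_le_mul_of_nonneg_right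
    (mul_le_mul_of_nonneg_left ?_ (inv_pos.2 hδ).le) hη.le)
  linarith

/-- The spectral representation of the resolvent. Both sides are continuous in `f` for the norm of
`ℓ²` and agree on the dense range of `U - l`. -/
lemma inner_walkResolvent (hC : (C : Matrix (Fin 2) (Fin 2) ℂ) = !![α, β; -conj β, conj α])
    (hα : α ≠ 0) (hβ : β ≠ 0) {l : ℂ} (hl : l ∉ {ζ : ℂ | ‖ζ‖ = 1 ∧ |ζ.re| ≤ ‖α‖})
    (f g : ℤ →₀ C2) :
    inner ℂ (toL2 g) (walkResolvent (constCoin C) l (toL2 f)) = resolventForm α β l f g := by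
  have hab := coin_relation hC
  have hα1 := norm_lt_one_of_coin_relation hβ hab
  obtain ⟨δ, hδ, h⟩ := exists_dist_le_of_notMem hl
  have hunit := isUnit_walk_sub hC hα hβ hl
  set A := walk (constCoin C) - algebraMap ℂ (L2Z →L[ℂ] L2Z) l with hA
  set Ψ := walkResolvent (constCoin C) l (toL2 f) with hΨ
  have hAΨ : A Ψ = toL2 f :=
    congrArg (fun T : L2Z →L[ℂ] L2Z => T (toL2 f)) (Ring.mul_inverse_cancel A hunit)
  set K := ‖toL2 g‖ + δ⁻¹ * (1 + ‖toL2 g‖ ^ 2) * (‖A‖ + 1) with hK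
  have hK0 : 0 ≤ K := by positivity
  have hest : ∀ η : ℝ, 0 < η → ‖inner ℂ (toL2 g) Ψ - resolventForm α β l f g‖ ≤ K * η := by
    intro η hη
    obtain ⟨k, hk⟩ := denseRange_toL2.exists_dist_lt Ψ hη
    rw [dist_eq_norm] at hk
    have e1 : toL2 (step C k - l • k + (-1 : ℂ) • f) = A (toL2 k - Ψ) := by
      rw [toL2_add, toL2_sub_smul, ← hA, map_sub, hAΨ, ← toL2ₗ_apply (_ • f), map_smul, toL2ₗ_apply,
        neg_one_smul, ← sub_eq_add_neg]
    have e2 : ‖toL2 (step C k - l • k + (-1 : ℂ) • f)‖ ≤ (‖A‖ + 1) * η := by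
      rw [e1]
      refine (A.le_opNorm _).trans (mul_le_mul (by linarith) ?_ (norm_nonneg _) (by positivity))
      rw [norm_sub_rev]; exact hk.le
    have e3 := norm_resolventForm_le_of_norm_le hα hα1 hab hδ h g (by positivity) e2
    rw [resolventForm_add hα hα1 hδ h, resolventForm_sub_smul hC hα hα1 hδ h,
      resolventForm_smul] at e3
    have e4 : inner ℂ (toL2 g) Ψ - resolventForm α β l f g = inner ℂ (toL2 g) (Ψ - toL2 k) +
        (inner ℂ (toL2 g) (toL2 k) + -1 * resolventForm α β l f g) := by
      rw [inner_sub_right]; ring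
    rw [e4, hK, add_mul]
    refine (norm_add_le _ _).trans (add_le_add ?_ (e3.trans_eq (by ring)))
    exact (norm_inner_le_norm _ _).trans (mul_le_mul_of_nonneg_left hk.le (norm_nonneg _))
  refine sub_eq_zero.1 (norm_le_zero_iff.1 (le_of_forall_pos_le_add fun ε hε => ?_))
  refine (hest (ε / (K + 1)) (by positivity)).trans ?_
  rw [zero_add, ← mul_div_assoc, div_le_iff₀ (by positivity)]
  nlinarith

end Resolvent

/-! ### The QW-Fourier transform on the circle -/

section FundamentalMatrix

open Real Set

variable {α β : ℂ} {C : Matrix.specialUnitaryGroup (Fin 2) ℂ}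

lemma transferProdPos_constCoin (l : ℂ) (n : ℕ) :
    transferProdPos (constCoin C) l n = transfer (constCoin C) l 0 ^ n := by
  induction n with
  | zero => rfl
  | succ n ih => rw [transferProdPos, ih, pow_succ']; rfl

lemma transferProdNeg_constCoin (l : ℂ) (n : ℕ) :
    transferProdNeg (constCoin C) l n = (transfer (constCoin C) l 0)⁻¹ ^ n := by
  induction n with
  | zero => rfl
  | succ n ih => rw [transferProdNeg, ih, pow_succ']; rfl

lemma fundMatrix_constCoin (l : ℂ) (x : ℤ) :
    fundMatrix (constCoin C) l x = transfer (constCoin C) l 0 ^ x := by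
  rw [fundMatrix]
  split_ifs with h
  · lift x to ℕ using h
    rw [transferProdPos_constCoin, Int.toNat_natCast, zpow_natCast]
  · obtain ⟨n, rfl⟩ : ∃ n : ℕ, x = -n := ⟨(-x).toNat, by omega⟩
    rw [transferProdNeg_constCoin, neg_neg, Int.toNat_natCast, Matrix.zpow_neg_natCast,
      Matrix.inv_pow']

lemma conjTranspose_transfer (hC : (C : Matrix (Fin 2) (Fin 2) ℂ) = !![α, β; -conj β, conj α])
    {z : ℂ} (hz : ‖z‖ = 1) :
    (transfer (constCoin C) z 0)ᴴ = dualTransfer α β z := by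
  have hz' : conj z⁻¹ = z := by rw [Complex.inv_eq_conj hz, Complex.conj_conj]
  have hc : ∀ x : ℤ, (constCoin C x : Matrix (Fin 2) (Fin 2) ℂ) = !![α, β; -conj β, conj α] :=
    fun _ => hC
  rw [map_inv₀] at hz'
  ext i j
  fin_cases i <;> fin_cases j <;> simp [transfer, dualTransfer, hc, hz', mul_assoc]
  ring

lemma qwFourier_constCoin (hC : (C : Matrix (Fin 2) (Fin 2) ℂ) = !![α, β; -conj β, conj α])
    (f : ℤ →₀ C2) (ζ : Circle) : qwFourier (constCoin C) f (ζ : ℂ) = fourier α β ζ f := by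
  have hζ := Circle.norm_coe ζ
  have h : (conj (ζ : ℂ))⁻¹ = (ζ : ℂ) := by rw [← Complex.inv_eq_conj hζ, inv_inv]
  rw [qwFourier, h, fourier, Finsupp.lsum_apply]
  simp only [fundMatrix_constCoin, Matrix.conjTranspose_zpow, conjTranspose_transfer hC hζ]
  rfl

end FundamentalMatrix

/-! ### The spectral matrix measure -/

section SpectralMeasure

open Real Set

variable {α β : ℂ} {C : Matrix.specialUnitaryGroup (Fin 2) ℂ}

lemma integrable_density (hα : α ≠ 0) (hα1 : ‖α‖ < 1) (i j : Fin 2) :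
    Integrable (fun ζ => density α β ζ i j) circleLebesgue := by
  have h := integrable_mul_density (β := β) hα hα1 (h := fun _ => 1) measurable_const (M := 1)
    (by simp) i j
  simpa only [one_mul] using h

/-- The matrix-valued measure with density `density α β`. -/
def spectralMeasure (α β : ℂ) : MatrixMeasure where
  measureOf' A := Matrix.of fun i j => circleLebesgue.withDensityᵥ (fun ζ => density α β ζ i j) A
  empty' := by ext i j; exact VectorMeasure.empty _
  not_measurable' A hA := by ext i j; exact VectorMeasure.not_measurable _ hA
  m_iUnion' f hf hd := Pi.hasSum.2 fun i => Pi.hasSum.2 fun j => VectorMeasure.m_iUnion _ hf hd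

lemma spectralMeasure_apply (A : Set Circle) (i j : Fin 2) :
    spectralMeasure α β A i j = circleLebesgue.withDensityᵥ (fun ζ => density α β ζ i j) A := rfl

lemma entry_spectralMeasure (i j : Fin 2) :
    entry (spectralMeasure α β) i j = circleLebesgue.withDensityᵥ (fun ζ => density α β ζ i j) :=
  VectorMeasure.ext fun _ _ => rfl

lemma spectralMeasure_apply_eq_integral (hα : α ≠ 0) (hα1 : ‖α‖ < 1) {A : Set Circle}
    (hA : MeasurableSet A) (i j : Fin 2) :
    spectralMeasure α β A i j = ∫ ζ in A, density α β ζ i j ∂circleLebesgue := by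
  rw [spectralMeasure_apply, withDensityᵥ_apply (integrable_density hα hα1 i j) hA]

lemma isPositive_spectralMeasure (hα : α ≠ 0) (hα1 : ‖α‖ < 1)
    (hab : α * conj α + β * conj β = 1) : IsPositive (spectralMeasure α β) := by
  intro A hA
  have hH : (spectralMeasure α β A)ᴴ = spectralMeasure α β A := by
    ext i j
    rw [Matrix.conjTranspose_apply, spectralMeasure_apply_eq_integral hα hα1 hA,
      spectralMeasure_apply_eq_integral hα hα1 hA, RCLike.star_def, ← integral_conj]
    congr 1
    funext ζ
    exact congrFun (congrFun (conjTranspose_density ζ) i) j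
  refine (posSemidef_iff_inner _ hH).2 fun u => ?_
  have hi : ∀ i j, Integrable (fun ζ => u j * conj (u i) * density α β ζ i j)
      (circleLebesgue.restrict A) := fun i j =>
    ((integrable_density hα hα1 i j).const_mul _).restrict
  have e : inner ℂ u (act (spectralMeasure α β A) u) =
      ∫ ζ in A, inner ℂ u (act (density α β ζ) u) ∂circleLebesgue := by
    simp only [inner_act]
    rw [integral_finsetSum _ fun i _ => integrable_finsetSum _ fun j _ => hi i j]
    refine Finset.sum_congr rfl fun i _ => ?_
    rw [integral_finsetSum _ fun j _ => hi i j]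
    refine Finset.sum_congr rfl fun j _ => ?_
    rw [integral_const_mul, spectralMeasure_apply_eq_integral hα hα1 hA]
  rw [e]
  exact integral_nonneg fun ζ =>
    (posSemidef_iff_inner _ (conjTranspose_density ζ)).1 (posSemidef_density hα hab ζ) u

lemma absolutelyContinuous_spectralMeasure (hα : α ≠ 0) (hα1 : ‖α‖ < 1) :
    (spectralMeasure α β).AbsolutelyContinuous circleLebesgue.toENNRealVectorMeasure := by
  intro A hA
  by_cases hm : MeasurableSet A
  · ext i j
    rw [Measure.toENNRealVectorMeasure_apply_measurable hm] at hA
    rw [spectralMeasure_apply_eq_integral hα hα1 hm, Measure.restrict_eq_zero.2 hA,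
      integral_zero_measure, Matrix.zero_apply]
  · exact VectorMeasure.not_measurable _ hm

lemma pairing_spectralMeasure (hα : α ≠ 0) (hα1 : ‖α‖ < 1) {h : Circle → ℂ}
    (hh : Measurable h) {M : ℝ} (hM : ∀ ζ ∈ arcs ‖α‖, ‖h ζ‖ ≤ M) {k l : Circle → C2}
    (hk : Continuous k) (hl : Continuous l) :
    pairing (spectralMeasure α β) h k l = spectralForm α β h k l := by
  rw [pairing, spectralForm_eq_sum hα hα1 hh hM hk hl]
  refine Finset.sum_congr rfl fun i _ => Finset.sum_congr rfl fun j _ => ?_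
  rw [entry_spectralMeasure]
  refine integral_withDensityᵥ_mul (integrable_density hα hα1 i j) ?_
    (integrable_spectralForm_entry hα hα1 hh hM hk hl i j)
  have hli : Continuous fun ζ => conj (l ζ i) :=
    Complex.continuous_conj.comp (continuous_coord hl i)
  exact ((hh.mul (continuous_coord hk j).measurable).mul hli.measurable).aestronglyMeasurable

lemma isSpectralMatrixMeasure_spectralMeasure
    (hC : (C : Matrix (Fin 2) (Fin 2) ℂ) = !![α, β; -conj β, conj α]) (hα : α ≠ 0) (hβ : β ≠ 0) :
    IsSpectralMatrixMeasure (constCoin C) (spectralMeasure α β) := by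
  have hab := coin_relation hC
  have hα1 := norm_lt_one_of_coin_relation hβ hab
  refine ⟨isPositive_spectralMeasure hα hα1 hab, fun l hl f g => ?_⟩
  rw [spectrum_walk hC hα hβ] at hl
  obtain ⟨δ, hδ, h⟩ := exists_dist_le_of_notMem hl
  simp only [qwFourier_constCoin hC]
  rw [pairing_spectralMeasure hα hα1 (measurable_inv_coe_sub l) (norm_inv_coe_sub_le hδ h)
    (continuous_fourier hα f) (continuous_fourier hα g), inner_walkResolvent hC hα hβ hl]
  rfl

/-- Since `F_ζ(0) = 1`, functions supported at the origin see the single entries of the measure. -/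
lemma pairing_single (hC : (C : Matrix (Fin 2) (Fin 2) ℂ) = !![α, β; -conj β, conj α])
    (S : MatrixMeasure) (h : Circle → ℂ) (i j : Fin 2) :
    pairing S h
        (fun ζ => qwFourier (constCoin C) (Finsupp.single 0 (EuclideanSpace.single j 1)) (ζ : ℂ))
        (fun ζ => qwFourier (constCoin C) (Finsupp.single 0 (EuclideanSpace.single i 1)) (ζ : ℂ)) =
      (entry S i j).integral h (ContinuousLinearMap.mul ℝ ℂ) := by
  simp only [qwFourier_constCoin hC, fourier_single, zpow_zero, act_one, pairing]
  rw [Finset.sum_eq_single i, Finset.sum_eq_single j]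
  · simp
  · intro b _ hb
    simp [hb]
  · simp
  · intro b _ hb
    simp [hb]
  · simp

/-- The spectral matrix measure is determined by the Cauchy transforms of its entries. -/
lemma eq_of_isSpectralMatrixMeasure
    (hC : (C : Matrix (Fin 2) (Fin 2) ℂ) = !![α, β; -conj β, conj α]) (hα : α ≠ 0) (hβ : β ≠ 0)
    {S S' : MatrixMeasure} (hS : IsSpectralMatrixMeasure (constCoin C) S)
    (hS' : IsSpectralMatrixMeasure (constCoin C) S') : S' = S := by
  have key : ∀ i j, entry S' i j = entry S i j := by
    intro i j
    refine sub_eq_zero.1 (eq_zero_of_cauchyTransform_eq_zero _ fun l hl => ?_)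
    have hl' : l ∉ spectrum ℂ (walk (constCoin C)) := by
      rw [spectrum_walk hC hα hβ]
      exact fun h => hl h.1
    have h1 := hS.2 l hl' (Finsupp.single 0 (EuclideanSpace.single j 1))
      (Finsupp.single 0 (EuclideanSpace.single i 1))
    have h2 := hS'.2 l hl' (Finsupp.single 0 (EuclideanSpace.single j 1))
      (Finsupp.single 0 (EuclideanSpace.single i 1))
    rw [pairing_single hC] at h1 h2
    rw [VectorMeasure.integral_sub_vectorMeasure
      (integrable_variation_of_continuous _ (continuous_inv_coe_sub hl))
      (integrable_variation_of_continuous _ (continuous_inv_coe_sub hl)), ← h1, ← h2, sub_self]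
  refine VectorMeasure.ext fun A _ => ?_
  ext i j
  exact congrArg (fun c : ComplexMeasure Circle => c A) (key i j)

end SpectralMeasure

end QuantumWalk

end

theorem theorem5p1 (α β : ℂ) (C : Matrix.specialUnitaryGroup (Fin 2) ℂ)
    (hC : (C : Matrix (Fin 2) (Fin 2) ℂ) = !![α, β; -conj β, conj α])
    (hα : α ≠ 0) (hβ : β ≠ 0) :
    spectrum ℂ (QuantumWalk.walk (QuantumWalk.constCoin C)) =
        {ζ : ℂ | ‖ζ‖ = 1 ∧ |ζ.re| ≤ ‖α‖} ∧
      ∃ S : QuantumWalk.MatrixMeasure,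
        QuantumWalk.IsSpectralMatrixMeasure (QuantumWalk.constCoin C) S ∧
        (∀ S' : QuantumWalk.MatrixMeasure,
          QuantumWalk.IsSpectralMatrixMeasure (QuantumWalk.constCoin C) S' → S' = S) ∧
        S.AbsolutelyContinuous QuantumWalk.circleLebesgue.toENNRealVectorMeasure ∧
        ∀ i j : Fin 2,
          Integrable
            (Set.indicator
              {ζ : Circle | (ζ : ℂ) ∈ spectrum ℂ (QuantumWalk.walk (QuantumWalk.constCoin C))}
              (fun ζ => QuantumWalk.homogeneousDensity α β ζ i j))
            QuantumWalk.circleLebesgue ∧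
          ∀ A : Set Circle, MeasurableSet A →
            S A i j = ∫ ζ in A, Set.indicator
              {ζ : Circle | (ζ : ℂ) ∈ spectrum ℂ (QuantumWalk.walk (QuantumWalk.constCoin C))}
              (fun ζ => QuantumWalk.homogeneousDensity α β ζ i j) ζ
              ∂QuantumWalk.circleLebesgue := by
  have hα1 := QuantumWalk.norm_lt_one_of_coin_relation hβ (QuantumWalk.coin_relation hC)
  have hσ := QuantumWalk.spectrum_walk hC hα hβ
  have hset : {ζ : Circle | (ζ : ℂ) ∈ spectrum ℂ (QuantumWalk.walk (QuantumWalk.constCoin C))} =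
      QuantumWalk.arcs ‖α‖ := by
    rw [hσ]
    ext ζ
    exact ⟨fun h => h.2, fun h => ⟨Circle.norm_coe ζ, h⟩⟩
  have hS := QuantumWalk.isSpectralMatrixMeasure_spectralMeasure hC hα hβ
  refine ⟨hσ, QuantumWalk.spectralMeasure α β, hS,
    fun S' hS' => QuantumWalk.eq_of_isSpectralMatrixMeasure hC hα hβ hS hS',
    QuantumWalk.absolutelyContinuous_spectralMeasure hα hα1, fun i j => ?_⟩
  have hd : (QuantumWalk.arcs ‖α‖).indicator
      (fun ζ => QuantumWalk.homogeneousDensity α β ζ i j) =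
      fun ζ => QuantumWalk.density α β ζ i j :=
    funext fun ζ => (QuantumWalk.density_apply ζ i j).symm
  rw [hset, hd]
  exact ⟨QuantumWalk.integrable_density hα hα1 i j,
    fun A hA => QuantumWalk.spectralMeasure_apply_eq_integral hα hα1 hA i j⟩
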